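/- Let $R$ be a finite commutative local principal ideal ring of odd characteristic, with maximal ideal $\mathfrak m=Rx$ of nilpotency degree $\ell\ge 1$ (the least $k$ with $\mathfrak m^k=0$) and residue field $R/\mathfrak m\cong F_q$. Let $A=R[t]/(t^2-x)=R\oplus Ry$, $y^2=x$, with the involution $(r+sy)^*=r-sy$. Let $V$ be a free $A$-module of finite rank $m\ge 1$ and let $h:V\times V\to A$ be a non-degenerate hermitian form: $h$ is $A$-linear in the second variable, $h(v,u)=h(u,v)^*$, and $v\mapsto h(v,-)$ is a bijection from $V$ to $\mathrm{Hom}_A(V,A)$. Let $U$ be the unitary group of $h$, i.e. the group of all $A$-linear automorphisms of $V$ preserving $h$. For $r_1,\dots,r_m\in R^\times$ say that $h$ is of type $\{r_1,\dots,r_m\}$ if it has matrix $\mathrm{diag}(r_1,\dots,r_m)$ relative to some basis of $V$. Let $\epsilon\in R^\times$ be a non-square. Let $\lambda:R^+\to\mathbb C^\times$ be a linear character whose kernel contains no non-zero ideal of $R$, and put $\mu(r+sy)=\lambda(2s)$, a linear character of $A^+$. Let $H$ be the Heisenberg group of all pairs $(a,v)$, $a\in A$, $v\in V$, with product $(a,v)(b,w)=(a+b+h(v,w),v+w)$,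 on which $U$ acts by ${}^g(a,v)=(a,gv)$. Let $V_0=y^\ell V$; then $h(V_0,V_0)=0$, and $(a,u)g\mapsto\mu(a)$ is a linear character of the subgroup $(A,V_0)\rtimes U$ of $H\rtimes U$. The Weil module $X$ of $U$ is the restriction to $U$ of the complex $H\rtimes U$-module induced from this linear character. Then the number of irreducible constituents of the $U$-module $X$ (which is the same whether they are counted up to isomorphism or with multiplicity) is equal to the number of orbits of $U$ acting on $V$. This common number is: - $q^\ell$ if $m=1$; - $2q^\ell-1$ if $m=2$ and $h$ is of type $\{1,-\epsilon\}$; - $2(q^\ell+q^{\ell-1}+\cdots+q)+1$ if $m>2$, or if $m=2$ and $h$ is of type $\{1,-1\}$. -/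

import Mathlib

noncomputable section

namespace RamifiedWeil

open IsLocalRing

/-- The quadratic extension `A = R[t]/(t² - x) = R ⊕ R y`, `y² = x`. Its `star` is the involution
`(r + s y)* = r - s y`. It is ramified when `x` generates the maximal ideal of the local ring `R`. -/
abbrev Ext (R : Type*) [CommRing R] (x : R) : Type _ := QuadraticAlgebra R x 0

/-- The nilpotency degree `ℓ` of the maximal ideal of `R`: the least `k` with `𝔪 ^ k = 0`. -/
def nilDeg (R : Type*) [CommRing R] [IsLocalRing R] : ℕ := nilpotencyClass (maximalIdeal R)

section Form

variable {R : Type*} [CommRing R] {x : R}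
variable {V : Type*} [AddCommGroup V] [Module (Ext R x) V]

/-- Sesquilinear forms `h : V × V → A`, linear in the second variable and `*`-semilinear in the
first one. -/
abbrev Form (R : Type*) [CommRing R] (x : R) (V : Type*) [AddCommGroup V] [Module (Ext R x) V] :
    Type _ := V →ₗ⋆[Ext R x] V →ₗ[Ext R x] Ext R x

/-- The unitary group `U` of `h`: all `A`-linear automorphisms of `V` that preserve `h`. -/
def unitaryGrp (h : Form R x V) : Subgroup (V ≃ₗ[Ext R x] V) where
  carrier := {g | ∀ u v, h (g u) (g v) = h u v}
  one_mem' := fun _ _ => rfl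
  mul_mem' := fun {a b} ha hb u v => by
    rw [LinearEquiv.mul_apply, LinearEquiv.mul_apply]
    exact (ha _ _).trans (hb _ _)
  inv_mem' := fun {a} ha u v => by
    have := ha (a⁻¹ u) (a⁻¹ v)
    rw [← LinearEquiv.mul_apply, ← LinearEquiv.mul_apply, mul_inv_cancel] at this
    exact this.symm

/-- `h` is of type `{r i | i ∈ ι}` if it has matrix `diag (r i)` relative to some basis of `V`. -/
def HasType {ι : Type*} (h : Form R x V) (r : ι → Rˣ) : Prop :=
  ∃ b : Module.Basis ι (Ext R x) V,
    (∀ i, h (b i) (b i) = algebraMap R (Ext R x) (r i)) ∧ ∀ i j, i ≠ j → h (b i) (b j) = 0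

/-- The Heisenberg group `H(h)`: pairs `(a, v)` with `a ∈ A`, `v ∈ V`. -/
@[ext]
structure Heis (h : Form R x V) where
  /-- the coordinate in `A` -/
  fst : Ext R x
  /-- the coordinate in `V` -/
  snd : V

namespace Heis

variable {h : Form R x V}

instance : Mul (Heis h) := ⟨fun k l => ⟨k.fst + l.fst + h k.snd l.snd, k.snd + l.snd⟩⟩
instance : One (Heis h) := ⟨⟨0, 0⟩⟩
instance : Inv (Heis h) := ⟨fun k => ⟨-k.fst + h k.snd k.snd, -k.snd⟩⟩

@[simp] theorem fst_mul (k l : Heis h) : (k * l).fst = k.fst + l.fst + h k.snd l.snd := rfl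
@[simp] theorem snd_mul (k l : Heis h) : (k * l).snd = k.snd + l.snd := rfl
@[simp] theorem fst_one : (1 : Heis h).fst = 0 := rfl
@[simp] theorem snd_one : (1 : Heis h).snd = 0 := rfl
@[simp] theorem fst_inv (k : Heis h) : (k⁻¹).fst = -k.fst + h k.snd k.snd := rfl
@[simp] theorem snd_inv (k : Heis h) : (k⁻¹).snd = -k.snd := rfl

instance : Group (Heis h) :=
  Group.ofLeftAxioms
    (fun a b c => Heis.ext
      (by simp only [fst_mul, snd_mul, map_add, LinearMap.add_apply]; ring)
      (by simp only [snd_mul]; abel))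
    (fun a => Heis.ext (by simp) (by simp))
    (fun a => Heis.ext (by simp) (by simp))

end Heis

/-- The action of `U` on the Heisenberg group by automorphisms, `ᵍ(a, v) = (a, g v)`. -/
def heisAct (h : Form R x V) : unitaryGrp h →* MulAut (Heis h) where
  toFun g :=
    { toFun := fun k => ⟨k.fst, g.1 k.snd⟩
      invFun := fun k => ⟨k.fst, g.1.symm k.snd⟩
      left_inv := fun k => by simp
      right_inv := fun k => by simp
      map_mul' := fun k l => Heis.ext (by simp [g.2 k.snd l.snd]) (by simp) }
  map_one' := rfl
  map_mul' := fun _ _ => rfl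

/-- The group `H ⋊ U`. -/
abbrev HU (h : Form R x V) : Type _ := Heis h ⋊[heisAct h] unitaryGrp h

/-- The character `μ = lam ∘ d` of `A⁺`, where `d (r + s y) = 2 s`. -/
def mu (x : R) (lam : AddChar R ℂ) : AddChar (Ext R x) ℂ where
  toFun a := lam (2 * a.im)
  map_zero_eq_one' := by simp
  map_add_eq_mul' a b := by simp [mul_add, AddChar.map_add_eq_mul]

end Form

section Weil

variable {R : Type*} [CommRing R] [IsLocalRing R] {x : R}
variable {V : Type*} [AddCommGroup V] [Module (Ext R x) V]

/-- The ideal `𝔦 = (A y) ^ ℓ` of `A`. -/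
def idealI (x : R) : Ideal (Ext R x) :=
  Ideal.span {(QuadraticAlgebra.omega : Ext R x)} ^ nilDeg R

/-- The submodule `V₀ = 𝔦 V` of `V`. -/
def V₀ (x : R) (V : Type*) [AddCommGroup V] [Module (Ext R x) V] : Submodule (Ext R x) V :=
  idealI x • ⊤

theorem map_mem_V₀ (g : V →ₗ[Ext R x] V) {v : V} (hv : v ∈ V₀ x V) : g v ∈ V₀ x V := by
  have h1 : (V₀ x V).map g ≤ V₀ x V := by
    rw [V₀, Submodule.map_smul'']
    exact smul_mono_right _ le_top
  exact h1 (Submodule.mem_map_of_mem hv)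

theorem omega_pow_eq_zero [Finite R] (hx : maximalIdeal R = Ideal.span {x}) :
    (QuadraticAlgebra.omega : Ext R x) ^ (nilDeg R + nilDeg R) = 0 := by
  have h1 : IsNilpotent (maximalIdeal R) :=
    (isArtinianRing_iff_isNilpotent_maximalIdeal R).mp inferInstance
  have h2 : maximalIdeal R ^ nilDeg R = 0 := Nat.sInf_mem h1
  have h3 : x ^ nilDeg R = 0 := by
    rw [hx, Ideal.span_singleton_pow, Ideal.zero_eq_bot, Ideal.span_singleton_eq_bot] at h2
    exact h2
  rw [← two_mul, pow_mul, pow_two, QuadraticAlgebra.omega_mul_omega_eq_algebraMap, map_zero,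
    zero_mul, add_zero, ← map_pow, h3, map_zero]

/-- `h` vanishes on `V₀`. -/
theorem form_V₀ [Finite R] (hx : maximalIdeal R = Ideal.span {x}) (h : Form R x V) {u v : V}
    (hu : u ∈ V₀ x V) (hv : v ∈ V₀ x V) : h u v = 0 := by
  have key : ∀ w ∈ V₀ x V, ∃ z, w = (QuadraticAlgebra.omega : Ext R x) ^ nilDeg R • z := by
    intro w hw
    rw [V₀, idealI, Ideal.span_singleton_pow, Submodule.ideal_span_singleton_smul] at hw
    obtain ⟨z, -, hz⟩ := (Submodule.mem_smul_pointwise_iff_exists _ _ _).mp hw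
    exact ⟨z, hz.symm⟩
  obtain ⟨a, rfl⟩ := key u hu
  obtain ⟨b, rfl⟩ := key v hv
  have hs : star (QuadraticAlgebra.omega : Ext R x) = -QuadraticAlgebra.omega := by
    ext <;> simp
  rw [map_smul, LinearMap.map_smulₛₗ h, LinearMap.smul_apply, smul_smul, starRingEnd_apply,
    star_pow, hs, neg_pow, mul_left_comm, ← pow_add, omega_pow_eq_zero hx, mul_zero, zero_smul]

/-- The subgroup `(A, V₀) ⋊ U` of `H ⋊ U`. -/
def indSubgroup (h : Form R x V) : Subgroup (HU h) where
  carrier := {k | k.left.snd ∈ V₀ x V}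
  one_mem' := (V₀ x V).zero_mem
  mul_mem' := fun {a _} ha hb =>
    (V₀ x V).add_mem ha (map_mem_V₀ (a.right.1 : V →ₗ[Ext R x] V) hb)
  inv_mem' := fun {a} ha =>
    map_mem_V₀ ((a.right⁻¹ : unitaryGrp h).1 : V →ₗ[Ext R x] V) ((V₀ x V).neg_mem ha)

/-- The linear character `(a, u) g ↦ μ(a)` of `(A, V₀) ⋊ U`. -/
def indChar [Finite R] (hx : maximalIdeal R = Ideal.span {x}) (h : Form R x V)
    (lam : AddChar R ℂ) : indSubgroup h →* ℂ where
  toFun k := mu x lam k.1.left.fst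
  map_one' := (mu x lam).map_zero_eq_one
  map_mul' a b := by
    have h0 : h a.1.left.snd (a.1.right.1 b.1.left.snd) = 0 :=
      form_V₀ hx h a.2 (map_mem_V₀ (a.1.right.1 : V →ₗ[Ext R x] V) b.2)
    have h1 : (a * b).1.left.fst = a.1.left.fst + b.1.left.fst +
      h a.1.left.snd (a.1.right.1 b.1.left.snd) := rfl
    rw [h1, h0, add_zero, AddChar.map_add_eq_mul]

/-- The one-dimensional module `Z` of `(A, V₀) ⋊ U`. -/
def indZ [Finite R] (hx : maximalIdeal R = Ideal.span {x}) (h : Form R x V)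
    (lam : AddChar R ℂ) : Representation ℂ (indSubgroup h) ℂ :=
  ((algebraMap ℂ (Module.End ℂ ℂ)) : ℂ →* Module.End ℂ ℂ).comp (indChar hx h lam)

/-- The representation of `H ⋊ U` on the induced module `X = ind Z`. Mathlib's `Representation.ind`
writes the element `k ⊗ ζ` of `ℂ[H ⋊ U] ⊗ Z` as the class of `k⁻¹ ⊗ ζ`. -/
def bigX [Finite R] (hx : maximalIdeal R = Ideal.span {x}) (h : Form R x V)
    (lam : AddChar R ℂ) :
    Representation ℂ (HU h) (Representation.IndV (indSubgroup h).subtype (indZ hx h lam)) :=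
  Representation.ind (indSubgroup h).subtype (indZ hx h lam)

/-- The Weil module `X` of `U`: the restriction of `ind Z` to `U`. -/
def weilRep [Finite R] (hx : maximalIdeal R = Ideal.span {x}) (h : Form R x V)
    (lam : AddChar R ℂ) :
    Representation ℂ (unitaryGrp h)
      (Representation.IndV (indSubgroup h).subtype (indZ hx h lam)) :=
  (bigX hx h lam).comp SemidirectProduct.inr

end Weil

section Constituents

/-- Isomorphism of irreducible submodules of a module `M`. -/
def simpleIso (S M : Type*) [Ring S] [AddCommGroup M] [Module S M] :
    Setoid {N : Submodule S M // IsSimpleModule S N} where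
  r N N' := Nonempty (N.1 ≃ₗ[S] N'.1)
  iseqv := ⟨fun N => ⟨.refl S N.1⟩, fun ⟨e⟩ => ⟨e.symm⟩, fun ⟨e⟩ ⟨e'⟩ => ⟨e.trans e'⟩⟩

/-- The number of pairwise non-isomorphic irreducible constituents of a complex representation. -/
def numConstituents {G X : Type*} [Group G] [AddCommGroup X] [Module ℂ X]
    (ρ : Representation ℂ G X) : ℕ :=
  Nat.card (Quotient (simpleIso (MonoidAlgebra ℂ G) ρ.asModule))

end Constituents

end RamifiedWeil

end

/-! The operator `heisOp v` by which `(0, v)` acts on `X` satisfies `heisOp v * heisOp w = μ(h(v,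
w)) • heisOp (v + w)`. The commutator pairing is non-degenerate because the character is primitive,
so `heisOp v` has trace zero for `v ≠ 0`, and these operators are linearly independent. Since `dim X
≤ |V / V₀|` and `|V| = |V / V₀|²`, they form a basis of `End X` (`exists_basis_heisOp`).

Conjugation by `U` permutes this basis as `U` permutes `V`, so `dim End_U X` is the number of
orbits. Moreover `End_U X` is commutative, by Gelfand's trick. Coordinatewise conjugation `s` in an
orthogonal basis is additive and reverses `h`, hence induces an anti-automorphism of `End X`. It
preserves every orbit, because `a*` and `a` differ by a factor of norm one in `A`, so it fixes
`End_U X` pointwise (`intertwiningMap_mul_comm`). Thus `X` is multiplicity free, and both counts of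
constituents equal the number of orbits.

For the orbits, write a non-zero vector as `yⁱ w` with `w` primitive and `i < 2ℓ`. By Witt's theorem
(`exists_smul_eq`) primitive vectors of equal length are conjugate, and the orbit of `yⁱ w` is
determined by `i` and `h(w, w)` modulo `x ^ ⌈(2ℓ - i) / 2⌉`. If primitive lengths take `N` values in
the residue field, this gives `2 N (1 + q + ⋯ + q^(ℓ-1)) + 1` orbits (`card_orbits`). Here `N`
counts the values of a diagonal quadratic form over `F_q` at non-zero vectors: `(q - 1) / 2`, `q -
1` or `q` in the three cases. -/

noncomputable section

namespace RamifiedWeil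

open IsLocalRing Representation

/-! ### Semisimple modules with commutative endomorphism ring -/

section MultiplicityFree

variable {S M : Type*} [Ring S] [AddCommGroup M] [Module S M]

/-- Isomorphism classes of simple submodules correspond to isotypic components. -/
theorem card_simpleIso_eq_card_isotypicComponents :
    Nat.card (Quotient (simpleIso S M)) = Nat.card (isotypicComponents S M) := by
  refine Nat.card_congr (Equiv.ofBijective (Quotient.lift (fun N =>
    (⟨isotypicComponent S M N.1, N.1, N.2, rfl⟩ : isotypicComponents S M)) ?_) ⟨?_, ?_⟩)
  · rintro N N' ⟨e⟩
    exact Subtype.ext e.isotypicComponent_eq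
  · rintro ⟨N⟩ ⟨N'⟩ hNN
    have h1 : isotypicComponent S M N.1 = isotypicComponent S M N'.1 := congrArg Subtype.val hNN
    have := N.2
    have := N'.2
    have h2 := (isIsotypicOfType_submodule_iff.mp
      (IsIsotypicOfType.isotypicComponent S M N'.1)) N.1 (h1 ▸ N.1.le_isotypicComponent)
    exact Quotient.sound h2
  · rintro ⟨c, N, hN, rfl⟩
    exact ⟨⟦⟨N, hN⟩⟧, rfl⟩

/-- A component is `Nⁿ` with `N` simple. Its endomorphism ring is a direct factor of `End M` and is
the ring of `n × n` matrices over `End N`, where matrix units fail to commute once `n ≥ 2`. -/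
theorem isSimpleModule_isotypicComponents_of_commute [IsSemisimpleModule S M]
    [Module.Finite S M] (hcomm : ∀ f g : Module.End S M, f * g = g * f)
    (c : isotypicComponents S M) : IsSimpleModule S c.1 := by
  classical
  have hc : ∀ f g : Module.End S c.1, f * g = g * f := by
    intro f g
    let e := IsSemisimpleModule.endAlgEquiv ℕ S M
    have h1 := hcomm (e.symm (Pi.single c f)) (e.symm (Pi.single c g))
    rw [← map_mul, ← map_mul] at h1
    have h2 := congrFun (e.symm.injective h1) c
    simpa using h2
  obtain ⟨n, hn, N, -, hN, ⟨e⟩⟩ :=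
    (IsIsotypic.isotypicComponents c.2).submodule_linearEquiv_fun
  let E := (e.conjAlgEquiv ℕ).trans (endVecAlgEquivMatrixEnd (Fin n) ℕ S N)
  have hM : ∀ a b : Matrix (Fin n) (Fin n) (Module.End S N), a * b = b * a := by
    intro a b
    apply E.symm.injective
    rw [map_mul, map_mul, hc]
  have := IsSimpleModule.nontrivial S N
  have hsub : Subsingleton (Fin n) := by
    constructor
    intro i j
    by_contra hij
    have h1 := hM (Matrix.single i j 1) (Matrix.single j i 1)
    rw [Matrix.single_mul_single_same, Matrix.single_mul_single_same] at h1
    have h2 := congrFun (congrFun h1 i) i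
    rw [Matrix.single_apply_same, Matrix.single_apply_of_ne _ _ _ _ _ (by tauto)] at h2
    exact one_ne_zero (mul_one (1 : Module.End S N) ▸ h2)
  have : Unique (Fin n) := ⟨⟨⟨0, Nat.pos_of_ne_zero hn.ne⟩⟩, fun _ => Subsingleton.elim _ _⟩
  exact IsSimpleModule.congr (e.trans (LinearEquiv.funUnique (Fin n) S N))

variable (k : Type*) [Field k] [IsAlgClosed k] [Algebra k S] [Module k M] [IsScalarTower k S M]
  [FiniteDimensional k M] [IsSemisimpleModule S M]

/-- A finite-dimensional semisimple module with commutative endomorphism ring is multiplicity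
free: the isotypic components are as many as the dimension of the endomorphism algebra. -/
theorem card_isotypicComponents_eq_finrank_end
    (hcomm : ∀ f g : Module.End S M, f * g = g * f) :
    Nat.card (isotypicComponents S M) = Module.finrank k (Module.End S M) := by
  classical
  have : Module.Finite S M := Module.Finite.of_restrictScalars_finite k S M
  have : IsNoetherian S M := isNoetherian_of_tower k inferInstance
  have : Finite (isotypicComponents S M) := inferInstance
  have := Fintype.ofFinite (isotypicComponents S M)
  rw [(IsSemisimpleModule.endAlgEquiv k S M).toLinearEquiv.finrank_eq]
  have h1 (c : isotypicComponents S M) : Module.finrank k (Module.End S c.1) = 1 ∧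
      Module.Finite k (Module.End S c.1) := by
    have := isSimpleModule_isotypicComponents_of_commute hcomm c
    have : FiniteDimensional k c.1 :=
      inferInstanceAs (FiniteDimensional k (c.1.restrictScalars k))
    have hb := IsSimpleModule.algebraMap_end_bijective_of_isAlgClosed (A := S) (V := c.1) k
    let e := LinearEquiv.ofBijective (Algebra.linearMap k (Module.End S c.1)) hb
    exact ⟨by rw [← e.finrank_eq, Module.finrank_self], Module.Finite.equiv e⟩
  have (c : isotypicComponents S M) : Module.Finite k (Module.End S c.1) := (h1 c).2
  have (c : isotypicComponents S M) : Module.Free k (Module.End S c.1) := inferInstance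
  rw [Module.finrank_pi_fintype]
  simp [h1, Nat.card_eq_fintype_card]

theorem length_eq_finrank_end_of_commute
    (hcomm : ∀ f g : Module.End S M, f * g = g * f) :
    Module.length S M = Module.finrank k (Module.End S M) := by
  classical
  have : Module.Finite S M := Module.Finite.of_restrictScalars_finite k S M
  have : IsNoetherian S M := isNoetherian_of_tower k inferInstance
  have := Fintype.ofFinite (isotypicComponents S M)
  rw [← card_isotypicComponents_eq_finrank_end k hcomm]
  have hinternal := DirectSum.isInternal_submodule_of_iSupIndep_of_iSup_eq_top
    ((sSupIndep_iff _).mp (sSupIndep_isotypicComponents S M))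
    ((sSup_eq_iSup' _).symm.trans (sSup_isotypicComponents S M))
  let e := (LinearEquiv.ofBijective (DirectSum.coeLinearMap _) hinternal).symm.trans
    (DirectSum.linearEquivFunOnFintype S (isotypicComponents S M) (fun c => c.1))
  rw [e.length_eq, Module.length_pi_of_fintype]
  have h1 (c : isotypicComponents S M) : Module.length S c.1 = 1 := by
    have := isSimpleModule_isotypicComponents_of_commute hcomm c
    exact Module.length_eq_one S c.1
  simp [h1, Nat.card_eq_fintype_card]

end MultiplicityFree

/-! ### Arithmetic of the ramified extension -/

section RingFacts

/-- The generator `y` of the maximal ideal of `A = R ⊕ R y`. -/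
abbrev unif {R : Type*} [CommRing R] (x : R) : Ext R x := QuadraticAlgebra.omega

variable {R : Type*} [CommRing R] {x : R}

theorem isUnit_two_of_odd_ringChar (hodd : Odd (ringChar R)) : IsUnit (2 : R) := by
  obtain ⟨k, hk⟩ := hodd
  have h1 : ((ringChar R : ℕ) : R) = 0 := ringChar.Nat.cast_ringChar
  rw [hk] at h1
  push_cast at h1
  exact IsUnit.of_mul_eq_one (-(k : R)) (by linear_combination -h1)

theorem star_unif : star (unif x) = -unif x := by
  ext <;> simp

theorem unif_sq : unif x ^ 2 = algebraMap R (Ext R x) x := by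
  rw [pow_two, QuadraticAlgebra.omega_mul_omega_eq_algebraMap]
  simp

theorem unif_pow_two_mul (n : ℕ) : unif x ^ (2 * n) = algebraMap R (Ext R x) (x ^ n) := by
  rw [pow_mul, unif_sq, map_pow]

theorem star_unif_pow (n : ℕ) : star (unif x ^ n) = (-1) ^ n * unif x ^ n := by
  rw [star_pow, star_unif, neg_pow]

theorem ext_re_of_im_eq_zero {a : Ext R x} (ha : a.im = 0) : a = algebraMap R (Ext R x) a.re := by
  ext <;> simp [ha]

theorem star_algebraMap (r : R) : star (algebraMap R (Ext R x) r) = algebraMap R (Ext R x) r := by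
  ext <;> simp

/-- The real part of `yᵏ a` is divisible by `x ^ ⌈k / 2⌉`. -/
theorem dvd_re_unif_pow_mul (k : ℕ) (a : Ext R x) :
    x ^ ((k + 1) / 2) ∣ (unif x ^ k * a).re := by
  obtain ⟨j, rfl | rfl⟩ := Nat.even_or_odd' k
  · rw [unif_pow_two_mul, show (2 * j + 1) / 2 = j by omega]
    generalize x ^ j = r
    exact ⟨a.re, by simp⟩
  · rw [pow_succ, unif_pow_two_mul, show (2 * j + 1 + 1) / 2 = j + 1 by omega]
    rw [pow_succ]
    generalize x ^ j = r
    exact ⟨a.im, by simp; ring⟩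

/-- `x ^ j` is divisible by `yᵏ` if `k ≤ 2 j`. -/
theorem algebraMap_pow_eq_unif_pow_mul {k j : ℕ} (hkj : k ≤ 2 * j) :
    algebraMap R (Ext R x) (x ^ j) = unif x ^ k * unif x ^ (2 * j - k) := by
  rw [← pow_add, ← unif_pow_two_mul]
  congr 1
  omega

variable [IsLocalRing R]

/-- The norm is `re² - x im²`, and `x` lies in the maximal ideal. -/
theorem isUnit_ext_iff (hx : maximalIdeal R = Ideal.span {x}) {a : Ext R x} :
    IsUnit a ↔ IsUnit a.re := by
  have hxm : x ∈ maximalIdeal R := hx ▸ Ideal.mem_span_singleton_self x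
  rw [QuadraticAlgebra.isUnit_iff_norm_isUnit, QuadraticAlgebra.norm_def]
  rw [← not_iff_not, ← mem_nonunits_iff, ← mem_nonunits_iff, ← mem_maximalIdeal,
    ← mem_maximalIdeal, zero_mul, zero_mul, add_zero,
    Submodule.sub_mem_iff_left _ (by
      rw [mul_assoc]; exact Ideal.mul_mem_right _ _ hxm)]
  rw [← pow_two]
  exact Ideal.IsPrime.pow_mem_iff_mem inferInstance 2 (by norm_num)

theorem not_isUnit_iff_mem (a : R) : ¬ IsUnit a ↔ a ∈ maximalIdeal R := by
  rw [mem_maximalIdeal, mem_nonunits_iff]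

theorem dvd_of_not_isUnit (hx : maximalIdeal R = Ideal.span {x}) {a : R} (ha : ¬ IsUnit a) :
    x ∣ a := by
  rw [not_isUnit_iff_mem, hx] at ha
  exact Ideal.mem_span_singleton.mp ha

theorem exists_eq_unif_mul (hx : maximalIdeal R = Ideal.span {x}) {a : Ext R x}
    (ha : ¬ IsUnit a) : ∃ b, a = unif x * b := by
  rw [isUnit_ext_iff hx] at ha
  obtain ⟨r, hr⟩ := dvd_of_not_isUnit hx ha
  exact ⟨⟨a.im, r⟩, by ext <;> simp [hr]⟩

theorem not_isUnit_unif (hx : maximalIdeal R = Ideal.span {x}) : ¬ IsUnit (unif x) := by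
  rw [isUnit_ext_iff hx]
  simp

theorem not_isUnit_unif_mul (hx : maximalIdeal R = Ideal.span {x}) (b : Ext R x) :
    ¬ IsUnit (unif x * b) := fun h => not_isUnit_unif hx (isUnit_of_mul_isUnit_left h)

theorem pow_ne_zero_of_lt_nilDeg (hx : maximalIdeal R = Ideal.span {x}) {n : ℕ}
    (hn : n < nilDeg R) : x ^ n ≠ 0 := by
  intro h0
  refine Nat.notMem_of_lt_sInf hn ?_
  change maximalIdeal R ^ n = 0
  rw [hx, Ideal.span_singleton_pow, h0, Ideal.span_singleton_eq_bot.mpr rfl, Ideal.zero_eq_bot]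

variable [Finite R]

theorem isNilpotent_maximalIdeal : IsNilpotent (maximalIdeal R) :=
  (isArtinianRing_iff_isNilpotent_maximalIdeal R).mp inferInstance

theorem nilDeg_pos : 0 < nilDeg R := by
  rw [Nat.pos_iff_ne_zero]
  intro h0
  have h2 : maximalIdeal R ^ nilDeg R = 0 := Nat.sInf_mem (isNilpotent_maximalIdeal (R := R))
  rw [h0, pow_zero] at h2
  exact one_ne_zero h2

theorem pow_nilDeg (hx : maximalIdeal R = Ideal.span {x}) : x ^ nilDeg R = 0 := by
  have h2 : maximalIdeal R ^ nilDeg R = 0 := Nat.sInf_mem (isNilpotent_maximalIdeal (R := R))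
  rw [hx, Ideal.span_singleton_pow, Ideal.zero_eq_bot, Ideal.span_singleton_eq_bot] at h2
  exact h2

theorem unif_pow_eq_zero (hx : maximalIdeal R = Ideal.span {x}) {n : ℕ}
    (hn : 2 * nilDeg R ≤ n) : unif x ^ n = 0 := by
  refine pow_eq_zero_of_le hn ?_
  rw [unif_pow_two_mul, pow_nilDeg hx, map_zero]

theorem unif_pow_ne_zero (hx : maximalIdeal R = Ideal.span {x}) {n : ℕ}
    (hn : n < 2 * nilDeg R) : unif x ^ n ≠ 0 := by
  intro h0
  -- The last power to survive is `y ^ (2ℓ - 1) = x ^ (ℓ - 1) y`.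
  have h1 : unif x ^ (2 * (nilDeg R - 1) + 1) = 0 := pow_eq_zero_of_le (by omega) h0
  rw [pow_succ, unif_pow_two_mul] at h1
  have h2 := congrArg QuadraticAlgebra.im h1
  simp only [QuadraticAlgebra.im_mul, QuadraticAlgebra.algebraMap_re,
    QuadraticAlgebra.algebraMap_im, QuadraticAlgebra.omega_im, QuadraticAlgebra.im_zero, mul_one,
    zero_mul, add_zero] at h2
  exact pow_ne_zero_of_lt_nilDeg hx (Nat.sub_lt nilDeg_pos one_pos) h2

theorem exists_unif_pow_mul_isUnit (hx : maximalIdeal R = Ideal.span {x}) (a : Ext R x) :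
    ∃ k u, IsUnit u ∧ a = unif x ^ k * u := by
  have key : ∀ n, (∃ b, a = unif x ^ n * b) ∨ ∃ k u, IsUnit u ∧ a = unif x ^ k * u := by
    intro n
    induction n with
    | zero => exact .inl ⟨a, by simp⟩
    | succ n ih =>
      obtain ⟨b, hb⟩ | h := ih
      · by_cases hu : IsUnit b
        · exact .inr ⟨n, b, hu, hb⟩
        · obtain ⟨c, rfl⟩ := exists_eq_unif_mul hx hu
          exact .inl ⟨c, by rw [hb, pow_succ, mul_assoc]⟩
      · exact .inr h
  obtain ⟨b, hb⟩ | h := key (2 * nilDeg R)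
  -- Here `a = 0`, which is `y ^ (2ℓ)` times the unit one.
  · refine ⟨2 * nilDeg R, 1, isUnit_one, ?_⟩
    rw [hb, unif_pow_eq_zero hx le_rfl, zero_mul, zero_mul]
  · exact h

/-- Conjugate elements of `A` differ by a factor of norm one. -/
theorem exists_star_eq_mul (hx : maximalIdeal R = Ideal.span {x}) (a : Ext R x) :
    ∃ u : Ext R x, star u * u = 1 ∧ star a = u * a := by
  obtain ⟨k, u, ⟨u, rfl⟩, rfl⟩ := exists_unif_pow_mul_isUnit hx a
  have hu : star (u : Ext R x) * star (↑u⁻¹ : Ext R x) = 1 := by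
    rw [← star_mul, Units.inv_mul, star_one]
  -- For `a = yᵏ u` one has `a* = (-1)ᵏ yᵏ u*`.
  refine ⟨(-1) ^ k * (star (u : Ext R x) * ↑u⁻¹), ?_, ?_⟩
  · rw [star_mul, star_mul, star_star, star_pow, star_neg, star_one]
    have h1 : ((-1 : Ext R x) ^ k) * (-1) ^ k = 1 := by rw [← mul_pow]; simp
    linear_combination (star (u : Ext R x) * star (↑u⁻¹ : Ext R x)) * (↑u * ↑u⁻¹ : Ext R x) * h1 +
      (↑u * ↑u⁻¹ : Ext R x) * hu + u.mul_inv
  · rw [star_mul, star_unif_pow]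
    linear_combination -((-1) ^ k * unif x ^ k * star (u : Ext R x)) * u.mul_inv

/-- The map `s ↦ 2 s + β s²` is a bijection of `R` when `β` is not a unit. -/
theorem exists_two_mul_add_mul_sq (h2 : IsUnit (2 : R)) {β : R} (hβ : ¬ IsUnit β) (d : R) :
    ∃ s, 2 * s + β * s ^ 2 = d := by
  -- Finiteness replaces Hensel's lemma: a difference of two values is `s - t` times the unit `2 + β
  -- (s + t)`.
  refine Finite.surjective_of_injective (f := fun s : R => 2 * s + β * s ^ 2) ?_ d
  intro s t hst
  have h3 : (s - t) * (2 + β * (s + t)) = 0 := by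
    simp only at hst
    linear_combination hst
  have h4 : IsUnit (2 + β * (s + t)) := by
    by_contra h5
    rw [not_isUnit_iff_mem] at h5 hβ
    have h6 := (Submodule.add_mem_iff_left _ (Ideal.mul_mem_right (s + t) _ hβ)).mp h5
    exact (not_isUnit_iff_mem _).mpr h6 h2
  exact sub_eq_zero.mp ((h4.mul_left_eq_zero).mp h3)

end RingFacts

/-! ### Unitary quasi-reflections and Witt's theorem -/

section Witt

variable {R : Type*} [CommRing R] {x : R}
variable {V : Type*} [AddCommGroup V] [Module (Ext R x) V]

theorem form_smul_left (h : Form R x V) (a : Ext R x) (u v : V) :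
    h (a • u) v = star a * h u v := by
  rw [LinearMap.map_smulₛₗ h, LinearMap.smul_apply, starRingEnd_apply, smul_eq_mul]

theorem form_smul_right (h : Form R x V) (a : Ext R x) (u v : V) :
    h u (a • v) = a * h u v := by
  rw [map_smul, smul_eq_mul]

/-- The value `h(v, v)`, as an element of `R`. -/
def quadVal (h : Form R x V) (v : V) : R := (h v v).re

/-- A vector `v` is primitive if some `h(w, v)` is a unit. -/
def IsPrimitiveVec (h : Form R x V) (v : V) : Prop := ∃ w, IsUnit (h w v)

theorem quadVal_unitary_smul {h : Form R x V} (g : unitaryGrp h) (v : V) : quadVal h (g • v) = quadVal h v :=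
  congrArg QuadraticAlgebra.re (g.2 v v)

variable [IsLocalRing R]

/-- `h` is a non-degenerate hermitian form over a ramified extension of `R`, and `2` is a unit. -/
structure IsNondegHerm (h : Form R x V) : Prop where
  two : IsUnit (2 : R)
  span : maximalIdeal R = Ideal.span {x}
  herm : ∀ u v, h v u = star (h u v)
  nondeg : Function.Bijective h

namespace IsNondegHerm

variable {h : Form R x V}

theorem quadVal_eq (H : IsNondegHerm h) {v : V} : h v v = algebraMap R (Ext R x) (quadVal h v) := by
  refine ext_re_of_im_eq_zero ?_
  have h1 := congrArg QuadraticAlgebra.im (H.herm v v)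
  rw [QuadraticAlgebra.im_star] at h1
  have h3 : 2 * (h v v).im = 0 := by linear_combination h1
  exact H.two.mul_right_eq_zero.mp h3

theorem isUnit_form_comm (H : IsNondegHerm h) {u v : V} : IsUnit (h u v) ↔ IsUnit (h v u) := by
  rw [H.herm u v]
  exact ⟨fun h1 => h1.star, fun h1 => by simpa using h1.star⟩

theorem quadVal_add (H : IsNondegHerm h) (u v : V) :
    quadVal h (u + v) = quadVal h u + quadVal h v + 2 * (h u v).re := by
  have h1 : (h v u).re = (h u v).re := by
    rw [H.herm u v, QuadraticAlgebra.re_star]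
    simp
  simp only [quadVal, map_add, LinearMap.add_apply, QuadraticAlgebra.re_add, h1]
  ring

theorem quadVal_smul (H : IsNondegHerm h) (a : Ext R x) (v : V) :
    quadVal h (a • v) = a.norm * quadVal h v := by
  rw [quadVal, form_smul_left, form_smul_right, H.quadVal_eq, ← mul_assoc, mul_comm (star a),
    ← QuadraticAlgebra.algebraMap_norm_eq_mul_star, ← map_mul]
  rfl

theorem isUnit_form_self (H : IsNondegHerm h) {v : V} : IsUnit (h v v) ↔ IsUnit (quadVal h v) := isUnit_ext_iff H.span

theorem isUnit_add (H : IsNondegHerm h) {a b : Ext R x} (ha : IsUnit a) (hb : ¬ IsUnit b) : IsUnit (a + b) := by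
  rw [isUnit_ext_iff H.span] at *
  by_contra hc
  rw [not_isUnit_iff_mem] at *
  rw [QuadraticAlgebra.re_add] at hc
  exact (not_isUnit_iff_mem _).mpr ((Submodule.add_mem_iff_left _ hb).mp hc) ha

theorem isUnit_two_ext (H : IsNondegHerm h) : IsUnit (2 : Ext R x) := by
  have h1 := H.two.map (algebraMap R (Ext R x))
  rwa [map_ofNat] at h1

theorem isUnit_two_mul_re (H : IsNondegHerm h) {a : Ext R x} (ha : IsUnit a) : IsUnit (2 * a.re) :=
  H.two.mul ((isUnit_ext_iff H.span).mp ha)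

/-- If `u, v` have non-unit lengths and `h(u, v)` is a unit, then `u + v` has unit length. -/
theorem isUnit_quadVal_add (H : IsNondegHerm h) {u v : V} (hu : ¬ IsUnit (quadVal h u)) (hv : ¬ IsUnit (quadVal h v))
    (huv : IsUnit (h u v)) : IsUnit (quadVal h (u + v)) := by
  rw [H.quadVal_add]
  by_contra hc
  rw [not_isUnit_iff_mem] at hu hv hc
  exact (not_isUnit_iff_mem _).mpr ((Submodule.add_mem_iff_right _ (add_mem hu hv)).mp hc)
    (H.isUnit_two_mul_re huv)

theorem eq_zero_of_form_eq_zero (H : IsNondegHerm h) {v : V} (hv : ∀ w, h v w = 0) : v = 0 :=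
  H.nondeg.1 (LinearMap.ext fun w => by rw [hv, map_zero, LinearMap.zero_apply])

theorem form_comm_eq_zero (H : IsNondegHerm h) {u v : V} (huv : h u v = 0) : h v u = 0 := by
  rw [H.herm u v, huv, star_zero]

theorem exists_unitary (H : IsNondegHerm h) [Finite V] (f : V →ₗ[Ext R x] V) (hf : ∀ u v, h (f u) (f v) = h u v) :
    ∃ g : unitaryGrp h, ∀ v, g • v = f v := by
  have hinj : Function.Injective f := by
    rw [← LinearMap.ker_eq_bot, LinearMap.ker_eq_bot']
    intro v hv
    refine H.eq_zero_of_form_eq_zero fun w => ?_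
    rw [← hf, hv, map_zero, LinearMap.zero_apply]
  exact ⟨⟨LinearEquiv.ofBijective f (Finite.injective_iff_bijective.mp hinj), hf⟩, fun v => rfl⟩

/-- The quasi-reflection `z ↦ z - u c⁻¹ h(u, z)` is unitary if `h(u, u) = c + c*`. -/
theorem exists_quasiReflection (H : IsNondegHerm h) [Finite V] {u : V} (c : (Ext R x)ˣ)
    (hc : h u u = c + star (c : Ext R x)) :
    ∃ g : unitaryGrp h, ∀ z, g • z = z - (↑c⁻¹ * h u z) • u := by
  refine H.exists_unitary (LinearMap.id - ((LinearMap.toSpanSingleton (Ext R x) V u) ∘ₗ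
    ((↑c⁻¹ : Ext R x) • h u))) ?_
  intro z w
  simp only [LinearMap.sub_apply, LinearMap.id_apply, LinearMap.comp_apply,
    LinearMap.toSpanSingleton_apply, LinearMap.smul_apply, smul_eq_mul, map_sub,
    form_smul_left, form_smul_right, star_mul, H.herm u z, hc]
  have hs : star (c : Ext R x) * star (↑c⁻¹ : Ext R x) = 1 := by
    rw [← star_mul, Units.inv_mul, star_one]
  linear_combination (h u w * star (h u z) * (↑c⁻¹ : Ext R x)) * hs +
    (h u w * star (h u z) * star (↑c⁻¹ : Ext R x)) * c.mul_inv

theorem exists_neg (H : IsNondegHerm h) [Finite V] : ∃ g : unitaryGrp h, ∀ v : V, g • v = -v := by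
  obtain ⟨g, hg⟩ := H.exists_unitary (-LinearMap.id) (by simp)
  exact ⟨g, fun v => by rw [hg]; rfl⟩

/-- Two vectors of equal length are in the same orbit if `h(v - w, v)` is a unit. -/
theorem exists_smul_eq_of_isUnit_sub (H : IsNondegHerm h) [Finite V] {v w : V} (hvw : quadVal h v = quadVal h w)
    (hu : IsUnit (h (v - w) v)) : ∃ g : unitaryGrp h, g • v = w := by
  obtain ⟨c, hc⟩ := hu
  have hl : h v v = h w w := by rw [H.quadVal_eq, H.quadVal_eq, hvw]
  -- With `c = h(v - w, v)` the reflection sends `v` to `v - (v - w)`; equality of lengths gives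
  -- `h(v - w, v - w) = c + c*`.
  obtain ⟨g, hg⟩ := H.exists_quasiReflection (u := v - w) c (by
    rw [hc]
    simp only [map_sub, LinearMap.sub_apply, star_sub, ← H.herm, hl]
    ring)
  refine ⟨g, ?_⟩
  rw [hg, ← hc, Units.inv_mul, one_smul, sub_sub_cancel]

theorem exists_isUnit_form_both (H : IsNondegHerm h) {v w : V} (hv : IsPrimitiveVec h v) (hw : IsPrimitiveVec h w) :
    ∃ z, IsUnit (h z v) ∧ IsUnit (h z w) := by
  obtain ⟨a, ha⟩ := hv
  obtain ⟨b, hb⟩ := hw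
  by_cases haw : IsUnit (h a w)
  · exact ⟨a, ha, haw⟩
  by_cases hbv : IsUnit (h b v)
  · exact ⟨b, hbv, hb⟩
  refine ⟨a + b, ?_, ?_⟩
  · rw [map_add, LinearMap.add_apply]
    exact H.isUnit_add ha hbv
  · rw [map_add, LinearMap.add_apply, add_comm]
    exact H.isUnit_add hb haw

/-- Witt's theorem for primitive vectors. -/
theorem exists_smul_eq (H : IsNondegHerm h) [Finite V] {v w : V} (hv : IsPrimitiveVec h v) (hw : IsPrimitiveVec h w)
    (hvw : quadVal h v = quadVal h w) : ∃ g : unitaryGrp h, g • v = w := by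
  -- If `v - w` does not yield a reflection, then `v + w` does, as `2` is a unit; composing with
  -- `-1` turns `-w` into `w`.
  have step : ∀ w, quadVal h v = quadVal h w → IsUnit (h w v) →
      ∃ g : unitaryGrp h, g • v = w := by
    intro w hvw hu
    by_cases h1 : IsUnit (h (v - w) v)
    · exact H.exists_smul_eq_of_isUnit_sub hvw h1
    obtain ⟨n, hn⟩ := H.exists_neg
    obtain ⟨g, hg⟩ := H.exists_smul_eq_of_isUnit_sub (w := -w)
      (hvw.trans (by rw [← hn, quadVal_unitary_smul])) (by
        have h2 : h (v - -w) v = 2 * h w v + h (v - w) v := by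
          simp only [map_sub, map_neg, LinearMap.sub_apply, LinearMap.neg_apply]
          ring
        rw [h2]
        exact H.isUnit_add (H.isUnit_two_ext.mul hu) h1)
    exact ⟨n * g, by rw [mul_smul, hg, hn, neg_neg]⟩
  by_cases h1 : IsUnit (h w v)
  · exact step w hvw h1
  by_cases h2 : IsUnit (quadVal h v)
  · refine H.exists_smul_eq_of_isUnit_sub hvw ?_
    rw [map_sub, LinearMap.sub_apply, sub_eq_add_neg]
    exact H.isUnit_add (H.isUnit_form_self.mpr h2) (by rwa [IsUnit.neg_iff])
  -- Now `h(v, v)` and `h(w, v)` are non-units. Reflecting `w` in a suitable `z` of unit length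
  -- changes `h(w, v)` by a unit and so reduces to `step`.
  obtain ⟨z, hzv, hzw, hzz⟩ : ∃ z, IsUnit (h z v) ∧ IsUnit (h z w) ∧ IsUnit (h z z) := by
    obtain ⟨z, hzv, hzw⟩ := H.exists_isUnit_form_both hv hw
    by_cases h3 : IsUnit (quadVal h z)
    · exact ⟨z, hzv, hzw, H.isUnit_form_self.mpr h3⟩
    refine ⟨z + v, ?_, ?_, ?_⟩
    · rw [map_add, LinearMap.add_apply]
      exact H.isUnit_add hzv (by rwa [H.isUnit_form_self])
    · rw [map_add, LinearMap.add_apply]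
      exact H.isUnit_add hzw (by rwa [H.isUnit_form_comm])
    · exact H.isUnit_form_self.mpr (H.isUnit_quadVal_add h3 h2 hzv)
  obtain ⟨t, ht⟩ := H.isUnit_two_ext
  obtain ⟨c, hc⟩ := hzz
  have hq : star ((c * t⁻¹ : (Ext R x)ˣ) : Ext R x) = (c * t⁻¹ : (Ext R x)ˣ) := by
    have h4 : star (↑t⁻¹ : Ext R x) = ↑t⁻¹ := by
      have h5 : star (t : Ext R x) = t := by rw [ht, star_ofNat]
      have h6 : star (↑t⁻¹ : Ext R x) * t = 1 := by
        rw [← h5, ← star_mul, Units.mul_inv, star_one]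
      exact Units.mul_eq_one_iff_eq_inv.mp h6
    rw [Units.val_mul, star_mul, h4, hc, ← H.herm, mul_comm]
  obtain ⟨g, hg⟩ := H.exists_quasiReflection (u := z) (c * t⁻¹) (by
    rw [hq, ← two_mul, ← ht, Units.val_mul, ← hc, mul_left_comm, Units.mul_inv, mul_one])
  obtain ⟨g', hg'⟩ := step (g • w) (by rw [hvw, quadVal_unitary_smul]) (by
    rw [hg, map_sub, LinearMap.sub_apply, form_smul_left, sub_eq_neg_add]
    refine H.isUnit_add ?_ h1
    rw [IsUnit.neg_iff]
    exact ((Units.isUnit _).mul hzw).star.mul hzv)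
  exact ⟨g⁻¹ * g', by rw [mul_smul, hg', inv_smul_smul]⟩

end IsNondegHerm

end Witt

/-! ### Primitive vectors and their lengths -/

section Primitive

variable {R : Type*} [CommRing R] [IsLocalRing R] {x : R}
variable {V : Type*} [AddCommGroup V] [Module (Ext R x) V]

instance instFiniteExt [Finite R] : Finite (Ext R x) :=
  Finite.of_equiv _ (QuadraticAlgebra.equivProd x 0).symm

namespace IsNondegHerm

variable {h : Form R x V}

theorem isPrimitiveVec_add_unif_smul (H : IsNondegHerm h) {v : V} (hv : IsPrimitiveVec h v)
    (z : V) : IsPrimitiveVec h (v + unif x • z) := by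
  obtain ⟨w, hw⟩ := hv
  refine ⟨w, ?_⟩
  rw [map_add, form_smul_right]
  exact H.isUnit_add hw (not_isUnit_unif_mul H.span _)

theorem exists_form_eq_one (H : IsNondegHerm h) {v : V} (hv : IsPrimitiveVec h v) :
    ∃ w, h v w = 1 := by
  obtain ⟨w, hw⟩ := hv
  obtain ⟨c, hc⟩ := H.isUnit_form_comm.mp hw
  exact ⟨(↑c⁻¹ : Ext R x) • w, by rw [form_smul_right, ← hc, Units.inv_mul]⟩

/-- By non-degeneracy the coordinate functional is `h(w, ·)` for some `w`. -/
theorem isPrimitiveVec_of_isUnit_repr (H : IsNondegHerm h) {ι : Type*} [Fintype ι]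
    (b : Module.Basis ι (Ext R x) V) {v : V} {i : ι} (hi : IsUnit (b.repr v i)) :
    IsPrimitiveVec h v := by
  obtain ⟨w, hw⟩ := H.nondeg.2 (b.coord i)
  exact ⟨w, by rw [hw]; exact hi⟩

theorem exists_eq_unif_smul (H : IsNondegHerm h) [Module.Free (Ext R x) V]
    [Module.Finite (Ext R x) V] {v : V} (hv : ¬ IsPrimitiveVec h v) : ∃ w, v = unif x • w := by
  let b := Module.Free.chooseBasis (Ext R x) V
  have h1 (i) : ∃ c, b.repr v i = unif x * c :=
    exists_eq_unif_mul H.span fun hi => hv (H.isPrimitiveVec_of_isUnit_repr b hi)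
  choose c hc using h1
  refine ⟨∑ i, c i • b i, ?_⟩
  rw [← b.sum_repr v, Finset.smul_sum]
  simp only [hc, smul_smul]

theorem exists_unif_pow_smul (H : IsNondegHerm h) [Module.Free (Ext R x) V]
    [Module.Finite (Ext R x) V] (n : ℕ) (v : V) :
    (∃ w, v = unif x ^ n • w) ∨ ∃ i < n, ∃ w, IsPrimitiveVec h w ∧ v = unif x ^ i • w := by
  induction n with
  | zero => exact .inl ⟨v, by simp⟩
  | succ n ih =>
    obtain ⟨w, hw⟩ | ⟨i, hi, hw⟩ := ih
    · by_cases hp : IsPrimitiveVec h w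
      · exact .inr ⟨n, n.lt_succ_self, w, hp, hw⟩
      · obtain ⟨z, rfl⟩ := H.exists_eq_unif_smul hp
        exact .inl ⟨z, by rw [hw, smul_smul, pow_succ]⟩
    · exact .inr ⟨i, by omega, hw⟩

variable [Finite R]

/-- A primitive vector is killed by no power of `y` below the `2ℓ`-th. -/
theorem le_of_unif_pow_smul_eq_zero (H : IsNondegHerm h) {v : V} (hv : IsPrimitiveVec h v)
    {n : ℕ} (hn : unif x ^ n • v = 0) : 2 * nilDeg R ≤ n := by
  by_contra hlt
  obtain ⟨w, hw⟩ := hv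
  have h1 : unif x ^ n * h w v = 0 := by rw [← form_smul_right, hn, map_zero]
  exact unif_pow_ne_zero H.span (not_le.mp hlt) (hw.mul_left_eq_zero.mp h1)

/-- Lengths of primitive vectors can be adjusted modulo `x ^ j`, `j ≥ 1`. -/
theorem exists_quadVal_eq (H : IsNondegHerm h) {w : V} (hw : IsPrimitiveVec h w) {j : ℕ}
    (hj : j ≠ 0) {c : R} (hc : x ^ j ∣ c - quadVal h w) :
    ∃ z, quadVal h (w + algebraMap R (Ext R x) (x ^ j) • z) = c := by
  obtain ⟨z, hz⟩ := H.exists_form_eq_one hw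
  obtain ⟨d, hd⟩ := hc
  -- As `h(w, z) = 1`, adding `xʲ s z` to `w` changes its length by `xʲ (2 s + xʲ h(z, z) s²)`.
  -- Since `j ≥ 1`, the bracket takes every value.
  have hu : ¬ IsUnit (x ^ j * quadVal h z) := by
    have hxm : x ∈ maximalIdeal R := H.span ▸ Ideal.mem_span_singleton_self x
    rw [not_isUnit_iff_mem]
    exact Ideal.mul_mem_right _ _ (Ideal.pow_mem_of_mem _ hxm _ (Nat.pos_of_ne_zero hj))
  obtain ⟨s, hs⟩ := exists_two_mul_add_mul_sq H.two hu d
  refine ⟨algebraMap R (Ext R x) s • z, ?_⟩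
  rw [smul_smul, ← map_mul, H.quadVal_add, H.quadVal_smul, form_smul_right, hz,
    QuadraticAlgebra.norm_algebraMap, mul_one, QuadraticAlgebra.algebraMap_re]
  linear_combination -hd + x ^ j * hs

/-- Primitive vectors of congruent lengths have the same orbit after multiplication by `yⁱ`. -/
theorem exists_smul_unif_pow_smul_eq (H : IsNondegHerm h) [Finite V] {v w : V} (hv : IsPrimitiveVec h v)
    (hw : IsPrimitiveVec h w) {i j : ℕ} (hj : j ≠ 0) (hij : 2 * nilDeg R ≤ i + 2 * j)
    (hvw : x ^ j ∣ quadVal h v - quadVal h w) :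
    ∃ g : unitaryGrp h, g • (unif x ^ i • w) = unif x ^ i • v := by
  obtain ⟨z, hz⟩ := H.exists_quadVal_eq hw hj hvw
  have hp : IsPrimitiveVec h (w + algebraMap R (Ext R x) (x ^ j) • z) := by
    rw [algebraMap_pow_eq_unif_pow_mul (show 1 ≤ 2 * j by omega), pow_one, mul_smul]
    exact H.isPrimitiveVec_add_unif_smul hw _
  obtain ⟨g, hg⟩ := H.exists_smul_eq hp hv hz
  refine ⟨g, ?_⟩
  -- The correction disappears after multiplication by `yⁱ`, because `yⁱ xʲ = y ^ (i + 2j) = 0`.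
  have h1 : unif x ^ i • w = unif x ^ i • (w + algebraMap R (Ext R x) (x ^ j) • z) := by
    rw [smul_add, smul_smul, ← unif_pow_two_mul, ← pow_add, unif_pow_eq_zero H.span hij,
      zero_smul, add_zero]
  rw [h1, ← hg]
  exact g.1.map_smul _ _

variable [Module.Free (Ext R x) V] [Module.Finite (Ext R x) V]

/-- A non-zero vector is a power of `y` times a primitive vector. -/
theorem exists_isPrimitiveVec_of_ne_zero (H : IsNondegHerm h) {v : V} (hv : v ≠ 0) :
    ∃ i < 2 * nilDeg R, ∃ w, IsPrimitiveVec h w ∧ v = unif x ^ i • w := by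
  obtain ⟨w, hw⟩ | h1 := H.exists_unif_pow_smul (2 * nilDeg R) v
  · rw [unif_pow_eq_zero H.span le_rfl, zero_smul] at hw
    exact absurd hw hv
  · exact h1

theorem exists_eq_of_unif_pow_smul_eq_zero (H : IsNondegHerm h) {v : V} {i : ℕ}
    (hi : unif x ^ i • v = 0) : ∃ w, v = unif x ^ (2 * nilDeg R - i) • w := by
  obtain h1 | ⟨k, hk, w, hw, rfl⟩ := H.exists_unif_pow_smul (2 * nilDeg R - i) v
  · exact h1
  · rw [smul_smul, ← pow_add] at hi
    have := H.le_of_unif_pow_smul_eq_zero hw hi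
    omega

/-- If unitary images agree after multiplication by `yⁱ`, then the lengths are congruent. -/
theorem dvd_quadVal_sub (H : IsNondegHerm h) {v w : V} {i : ℕ}
    (hvw : unif x ^ i • v = unif x ^ i • w) :
    x ^ ((2 * nilDeg R - i + 1) / 2) ∣ quadVal h v - quadVal h w := by
  obtain ⟨z, hz⟩ := H.exists_eq_of_unif_pow_smul_eq_zero (v := v - w) (i := i)
    (by rw [smul_sub, hvw, sub_self])
  generalize 2 * nilDeg R - i = k at hz ⊢
  obtain rfl : v = w + unif x ^ k • z := by rw [← hz, add_sub_cancel]
  rw [H.quadVal_add, H.quadVal_smul, form_smul_right, add_assoc, add_sub_cancel_left]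
  -- The cross term accounts for the exponent `⌈k / 2⌉`; the quadratic term carries the norm of
  -- `yᵏ`, which is `± xᵏ`.
  refine dvd_add ?_ (Dvd.dvd.mul_left (dvd_re_unif_pow_mul k _) _)
  refine Dvd.dvd.mul_right ?_ _
  have h1 : QuadraticAlgebra.norm (unif x) = -x := by simp [QuadraticAlgebra.norm_def]
  rw [map_pow, h1, neg_pow]
  exact Dvd.dvd.mul_left (pow_dvd_pow _ (by omega)) _

end IsNondegHerm

end Primitive

/-! ### Orthogonal bases -/

section OrthogonalBasis

variable {R : Type*} [CommRing R] {x : R}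
variable {V : Type*} [AddCommGroup V] [Module (Ext R x) V]

/-- A finite orthogonal family of vectors of unit length. -/
structure IsOrthFamily (h : Form R x V) {n : ℕ} (f : Fin n → V) : Prop where
  isUnit : ∀ i, IsUnit (h (f i) (f i))
  orth : ∀ i j, i ≠ j → h (f i) (f j) = 0

theorem IsOrthFamily.form_sum {h : Form R x V} {n : ℕ} {f : Fin n → V} (hf : IsOrthFamily h f)
    (c : Fin n → Ext R x) (j : Fin n) : h (f j) (∑ i, c i • f i) = c j * h (f j) (f j) := by
  rw [map_sum, Finset.sum_eq_single j, form_smul_right]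
  · intro i _ hij
    rw [form_smul_right, hf.orth j i hij.symm, mul_zero]
  · simp

theorem IsOrthFamily.linearIndependent {h : Form R x V} {n : ℕ} {f : Fin n → V}
    (hf : IsOrthFamily h f) : LinearIndependent (Ext R x) f := by
  rw [Fintype.linearIndependent_iff]
  intro c hc j
  have h1 := hf.form_sum c j
  rw [hc, map_zero] at h1
  exact (hf.isUnit j).mul_left_eq_zero.mp h1.symm

namespace IsNondegHerm

variable [IsLocalRing R] {h : Form R x V} [Finite R] [Module.Free (Ext R x) V] [Module.Finite (Ext R x) V]

/-- Suppose no vector orthogonal to `f` has unit length. Then none is primitive: the orthogonal part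
of a partner would pair with it to a unit, and their sum would have unit length. So the orthogonal
part of any vector is divisible by `y`; iterating, `V` is the span plus `yᵏ V` for all `k`, hence
the span itself. -/
theorem exists_extend_orthFamily (H : IsNondegHerm h) {n : ℕ} {f : Fin n → V}
    (hf : IsOrthFamily h f) (hspan : Submodule.span (Ext R x) (Set.range f) ≠ ⊤) :
    ∃ f' : Fin (n + 1) → V, IsOrthFamily h f' := by
  obtain ⟨w, hw, hu⟩ : ∃ w, (∀ i, h (f i) w = 0) ∧ IsUnit (h w w) := by
    by_contra! hno
    apply hspan
    have hproj : ∀ z, ∃ s ∈ Submodule.span (Ext R x) (Set.range f), ∀ i, h (f i) (z - s) = 0 := by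
      intro z
      choose c hc using hf.isUnit
      refine ⟨∑ i, (↑(c i)⁻¹ * h (f i) z) • f i, ?_, fun i => ?_⟩
      · exact Submodule.sum_mem _ fun i _ =>
          Submodule.smul_mem _ _ (Submodule.subset_span ⟨i, rfl⟩)
      · rw [map_sub, hf.form_sum, ← hc, mul_right_comm, Units.inv_mul, one_mul, sub_self]
    have hperp : ∀ s ∈ Submodule.span (Ext R x) (Set.range f), ∀ w, (∀ i, h (f i) w = 0) →
        h w s = 0 := by
      intro s hs w hw
      refine Submodule.span_induction (p := fun s _ => h w s = 0) ?_ (map_zero _) ?_ ?_ hs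
      · rintro _ ⟨i, rfl⟩
        exact H.form_comm_eq_zero (hw i)
      · intro a b _ _ ha hb
        rw [map_add, ha, hb, add_zero]
      · intro a b _ hb
        rw [form_smul_right, hb, mul_zero]
    have hnp : ∀ w, (∀ i, h (f i) w = 0) → ¬ IsPrimitiveVec h w := by
      rintro w hw ⟨v, hv⟩
      obtain ⟨s, hs, hvs⟩ := hproj v
      rw [H.isUnit_form_comm] at hv
      have h1 : h w v = h w (v - s) := by rw [map_sub, hperp s hs w hw, sub_zero]
      rw [h1] at hv
      have h2 := H.isUnit_quadVal_add (H.isUnit_form_self.not.mp (hno w hw))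
        (H.isUnit_form_self.not.mp (hno _ hvs)) hv
      exact hno (w + (v - s)) (fun i => by rw [map_add, hw, hvs, add_zero])
        (H.isUnit_form_self.mpr h2)
    have hstep : ∀ k z, ∃ s ∈ Submodule.span (Ext R x) (Set.range f), ∃ z',
        z = s + unif x ^ k • z' := by
      intro k
      induction k with
      | zero => exact fun z => ⟨0, zero_mem _, z, by simp⟩
      | succ k ih =>
        intro z
        obtain ⟨s, hs, z', rfl⟩ := ih z
        obtain ⟨t, ht, hzt⟩ := hproj z'
        obtain ⟨w, hw⟩ := H.exists_eq_unif_smul (hnp _ hzt)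
        refine ⟨s + unif x ^ k • t, add_mem hs (Submodule.smul_mem _ _ ht), w, ?_⟩
        rw [pow_succ, mul_smul, ← hw, smul_sub]
        abel
    rw [eq_top_iff]
    intro z _
    obtain ⟨s, hs, z', rfl⟩ := hstep (2 * nilDeg R) z
    rwa [unif_pow_eq_zero H.span le_rfl, zero_smul, add_zero]
  refine ⟨Fin.cons w f, ⟨fun i => ?_, fun i j hij => ?_⟩⟩
  · refine Fin.cases ?_ (fun i => ?_) i
    · exact hu
    · exact hf.isUnit i
  · induction i using Fin.cases with
    | zero =>
      induction j using Fin.cases with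
      | zero => exact absurd rfl hij
      | succ j => exact H.form_comm_eq_zero (hw j)
    | succ i =>
      induction j using Fin.cases with
      | zero => exact hw i
      | succ j => exact hf.orth i j fun e => hij (congrArg _ e)

/-- Every non-degenerate hermitian form has an orthogonal basis. -/
theorem exists_hasType (H : IsNondegHerm h) :
    ∃ r : Fin (Module.finrank (Ext R x) V) → Rˣ, HasType h r := by
  obtain ⟨n, ⟨f, hf⟩, hmax⟩ : ∃ n, (∃ f : Fin n → V, IsOrthFamily h f) ∧
      ¬ ∃ f : Fin (n + 1) → V, IsOrthFamily h f := by
    by_contra! hno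
    have hall : ∀ n, ∃ f : Fin n → V, IsOrthFamily h f := by
      intro n
      induction n with
      | zero => exact ⟨Fin.elim0, ⟨fun i => i.elim0, fun i => i.elim0⟩⟩
      | succ n ih => exact hno n ih
    obtain ⟨f, hf⟩ := hall (Module.finrank (Ext R x) V + 1)
    have := hf.linearIndependent.fintype_card_le_finrank
    simp at this
  have hspan : Submodule.span (Ext R x) (Set.range f) = ⊤ := by
    by_contra hne
    exact hmax (H.exists_extend_orthFamily hf hne)
  let b := Module.Basis.mk hf.linearIndependent hspan.ge
  obtain rfl : n = Module.finrank (Ext R x) V := by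
    rw [Module.finrank_eq_card_basis b, Fintype.card_fin]
  choose r hr using fun i => H.isUnit_form_self.mp (hf.isUnit i)
  refine ⟨r, b, fun i => ?_, fun i j hij => ?_⟩
  · rw [Module.Basis.mk_apply, H.quadVal_eq, hr]
  · rw [Module.Basis.mk_apply, Module.Basis.mk_apply]
    exact hf.orth i j hij

end IsNondegHerm

end OrthogonalBasis

/-! ### Counting the orbits -/

section Counting

theorem card_preimage_of_surjective {G F : Type*} [AddCommGroup G] [AddCommGroup F] (f : G →+ F)
    (hf : Function.Surjective f) (S : Set F) :
    Nat.card (f ⁻¹' S) = Nat.card S * Nat.card f.ker := by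
  choose r hr using hf
  rw [← Nat.card_prod]
  refine (Nat.card_congr (Equiv.ofBijective
    (fun p : S × f.ker => (⟨r p.1 + p.2, ?_⟩ : f ⁻¹' S)) ⟨?_, ?_⟩)).symm
  · have h1 : f p.2 = 0 := p.2.2
    rw [Set.mem_preimage, map_add, hr, h1, add_zero]
    exact p.1.2
  · rintro ⟨s, k⟩ ⟨t, l⟩ hst
    have h0 : r s + k = r t + l := congrArg Subtype.val hst
    have hk : f k = 0 := k.2
    have hl : f l = 0 := l.2
    have h1 := congrArg f h0
    rw [map_add, map_add, hr, hr, hk, hl, add_zero, add_zero] at h1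
    obtain rfl : s = t := Subtype.ext h1
    rw [Prod.mk.injEq]
    exact ⟨rfl, Subtype.ext (add_left_cancel h0)⟩
  · rintro ⟨g, hg⟩
    refine ⟨⟨⟨f g, hg⟩, ⟨g - r (f g), ?_⟩⟩, Subtype.ext ?_⟩
    · rw [AddMonoidHom.mem_ker, map_sub, hr, sub_self]
    · simp

variable {R : Type*} [CommRing R] {x : R}

theorem span_pow_le {j k : ℕ} (hjk : j ≤ k) :
    Ideal.span {x ^ k} ≤ Ideal.span ({x ^ j} : Set R) :=
  Ideal.span_singleton_le_span_singleton.mpr (pow_dvd_pow x hjk)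

theorem residue_eq_residue_iff [IsLocalRing R] (hx : maximalIdeal R = Ideal.span {x}) {a b : R} :
    residue R a = residue R b ↔ x ∣ a - b := by
  rw [← sub_eq_zero, ← map_sub, residue_eq_zero_iff, hx, Ideal.mem_span_singleton]

instance instFiniteResidueField [IsLocalRing R] [Finite R] : Finite (ResidueField R) :=
  Finite.of_surjective _ (residue_surjective (R := R))

variable [IsLocalRing R]

/-- The kernel of `R / x^(j+1) → R / x^j` is the image of multiplication by `x^j`, a copy of the
residue field as long as `x^j ≠ 0`. -/
theorem card_quotient_span_pow [Finite R] (hx : maximalIdeal R = Ideal.span {x}) {j : ℕ}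
    (hj : j ≤ nilDeg R) :
    Nat.card (R ⧸ Ideal.span ({x ^ j} : Set R)) = Nat.card (ResidueField R) ^ j := by
  induction j with
  | zero =>
    rw [pow_zero, pow_zero, Ideal.span_singleton_one]
    exact Nat.card_unique
  | succ j ih =>
    let f := (Ideal.Quotient.factor (span_pow_le (x := x) (Nat.le_succ j))).toAddMonoidHom
    have hf : Function.Surjective f := Ideal.Quotient.factor_surjective (span_pow_le (Nat.le_succ j))
    have h1 := card_preimage_of_surjective f hf Set.univ
    rw [Set.preimage_univ, Nat.card_coe_set_eq, Set.ncard_univ, Nat.card_coe_set_eq,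
      Set.ncard_univ, ih (by omega)] at h1
    rw [h1, pow_succ (Nat.card _)]
    congr 1
    let φ : R →+ R ⧸ Ideal.span ({x ^ (j + 1)} : Set R) :=
      (Ideal.Quotient.mk _).toAddMonoidHom.comp (AddMonoidHom.mulLeft (x ^ j))
    have hφ (r : R) : φ r = Ideal.Quotient.mk _ (x ^ j * r) := rfl
    have hr : φ.range = f.ker := by
      ext c
      obtain ⟨c, rfl⟩ := Ideal.Quotient.mk_surjective c
      rw [AddMonoidHom.mem_ker, show f (Ideal.Quotient.mk _ c) = Ideal.Quotient.mk _ c from rfl,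
        Ideal.Quotient.eq_zero_iff_mem, Ideal.mem_span_singleton, AddMonoidHom.mem_range]
      constructor
      · rintro ⟨r, hr⟩
        rw [hφ, Ideal.Quotient.eq, Ideal.mem_span_singleton] at hr
        have h2 := ((pow_dvd_pow x (Nat.le_succ j)).trans hr)
        exact (dvd_sub_right (Dvd.intro r rfl)).mp h2
      · rintro ⟨r, rfl⟩
        exact ⟨r, rfl⟩
    have hk : φ.ker = (maximalIdeal R).toAddSubgroup := by
      ext r
      rw [AddMonoidHom.mem_ker, hφ, Ideal.Quotient.eq_zero_iff_mem, Ideal.mem_span_singleton,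
        Submodule.mem_toAddSubgroup]
      constructor
      · rintro ⟨s, hs⟩
        by_contra hr
        rw [← not_isUnit_iff_mem, not_not] at hr
        have hu : IsUnit (r - x * s) := by
          by_contra hu
          rw [not_isUnit_iff_mem] at hu
          have h2 : x * s ∈ maximalIdeal R :=
            Ideal.mul_mem_right _ _ (hx ▸ Ideal.mem_span_singleton_self x)
          exact (not_isUnit_iff_mem _).mpr ((Submodule.sub_mem_iff_left _ h2).mp hu) hr
        have h3 : x ^ j * (r - x * s) = 0 := by rw [mul_sub, hs]; ring
        exact pow_ne_zero_of_lt_nilDeg hx (by omega) (hu.mul_left_eq_zero.mp h3)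
      · intro hr
        rw [hx, Ideal.mem_span_singleton] at hr
        rw [pow_succ]
        exact mul_dvd_mul_left _ hr
    rw [← hr]
    refine (Nat.card_congr (QuotientAddGroup.quotientKerEquivRange φ).toEquiv).symm.trans ?_
    rw [hk]
    rfl

variable {V : Type*} [AddCommGroup V] [Module (Ext R x) V]

/-- The classes modulo `x ^ j` of the lengths of primitive vectors. -/
def primVal (h : Form R x V) (j : ℕ) : Set (R ⧸ Ideal.span ({x ^ j} : Set R)) :=
  {c | ∃ v, IsPrimitiveVec h v ∧ Ideal.Quotient.mk _ (quadVal h v) = c}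

/-- The residue classes of the lengths of primitive vectors. -/
def primRes (h : Form R x V) : Set (ResidueField R) :=
  {c | ∃ v, IsPrimitiveVec h v ∧ residue R (quadVal h v) = c}

namespace IsNondegHerm

variable {h : Form R x V} [Finite R]

/-- Primitive lengths can be changed freely modulo `x`, so these classes are the full preimage of
`primRes h`. -/
theorem card_primVal (H : IsNondegHerm h) {j : ℕ} (hj : j + 1 ≤ nilDeg R) :
    Nat.card (primVal h (j + 1)) =
      Nat.card (primRes h) * Nat.card (ResidueField R) ^ j := by
  have hle : Ideal.span ({x ^ (j + 1)} : Set R) ≤ maximalIdeal R := by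
    rw [H.span, Ideal.span_singleton_le_span_singleton]
    exact dvd_pow_self x (Nat.succ_ne_zero j)
  let f : R ⧸ Ideal.span ({x ^ (j + 1)} : Set R) →+ ResidueField R :=
    (Ideal.Quotient.factor hle).toAddMonoidHom
  have hfmk (r : R) : f (Ideal.Quotient.mk _ r) = residue R r := rfl
  have hf : Function.Surjective f := Ideal.Quotient.factor_surjective hle
  have hpre : primVal h (j + 1) = f ⁻¹' primRes h := by
    ext c
    constructor
    · rintro ⟨v, hv, rfl⟩
      exact ⟨v, hv, rfl⟩
    · obtain ⟨c, rfl⟩ := Ideal.Quotient.mk_surjective c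
      rintro ⟨v, hv, hc⟩
      rw [hfmk, residue_eq_residue_iff H.span] at hc
      obtain ⟨z, hz⟩ := H.exists_quadVal_eq hv one_ne_zero (c := c)
        (by rw [pow_one, ← neg_sub, dvd_neg]; exact hc)
      refine ⟨_, ?_, congrArg _ hz⟩
      rw [algebraMap_pow_eq_unif_pow_mul (show 1 ≤ 2 * 1 by omega), pow_one, mul_smul]
      exact H.isPrimitiveVec_add_unif_smul hv _
  rw [hpre, card_preimage_of_surjective f hf]
  congr 1
  have h1 := card_preimage_of_surjective f hf Set.univ
  rw [Set.preimage_univ, Nat.card_coe_set_eq, Set.ncard_univ, Nat.card_coe_set_eq,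
    Set.ncard_univ, card_quotient_span_pow H.span hj, pow_succ, mul_comm] at h1
  exact (Nat.eq_of_mul_eq_mul_left Nat.card_pos h1).symm

variable [Module.Free (Ext R x) V] [Module.Finite (Ext R x) V]

theorem card_orbits (H : IsNondegHerm h) :
    Nat.card (MulAction.orbitRel.Quotient (unitaryGrp h) V) =
      2 * (Nat.card (primRes h) * ∑ i ∈ Finset.range (nilDeg R),
        Nat.card (ResidueField R) ^ i) + 1 := by
  have : Finite V := Module.finite_of_finite (Ext R x)
  set ℓ := nilDeg R with hℓ
  -- The index is `k = 2ℓ - 1 - i`, for which `⌈(2ℓ - i) / 2⌉ = k / 2 + 1`. The least power of `y`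
  -- killing `yⁱ w` is the `(k + 1)`-st, so `k` is an invariant of the orbit.
  let T (k : Fin (2 * ℓ)) := primVal h (k / 2 + 1)
  have hT (k : Fin (2 * ℓ)) (c : T k) : ∃ v, IsPrimitiveVec h v ∧
    Ideal.Quotient.mk _ (quadVal h v) = c.1 := c.2
  choose rep hrep hval using hT
  let vec (p : Σ k, T k) : V := unif x ^ (2 * ℓ - 1 - p.1) • rep p.1 p.2
  have hvec (p : Σ k, T k) (n : ℕ) (hn : unif x ^ n • vec p = 0) : p.1 < n := by
    simp only [vec, smul_smul, ← pow_add] at hn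
    have h1 := H.le_of_unif_pow_smul_eq_zero (hrep p.1 p.2) hn
    have := p.1.2
    omega
  have hvec' (p : Σ k, T k) : unif x ^ (p.1 + 1 : ℕ) • vec p = 0 := by
    have := p.1.2
    simp only [vec, smul_smul, ← pow_add]
    rw [unif_pow_eq_zero H.span (by omega), zero_smul]
  have hsmul (g : unitaryGrp h) (a : Ext R x) (v : V) : a • g • v = g • a • v :=
    (g.1.map_smul a v).symm
  let Φ : Option (Σ k, T k) → MulAction.orbitRel.Quotient (unitaryGrp h) V := fun o =>
    Quotient.mk'' (o.elim 0 vec)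
  have hinj : Function.Injective Φ := by
    have hrel (o o' : Option (Σ k, T k)) (e : Φ o = Φ o') : ∃ g : unitaryGrp h,
        g • o'.elim 0 vec = o.elim 0 vec := Quotient.exact e
    intro o o' e
    obtain ⟨g, hg⟩ := hrel o o' e
    match o, o' with
    | none, none => rfl
    | none, some p =>
      simp only [Option.elim] at hg
      rw [smul_eq_zero_iff_eq] at hg
      exact absurd (hvec p 0 (by rw [hg, smul_zero])) (Nat.not_lt_zero _)
    | some p, none =>
      simp only [Option.elim, smul_zero] at hg
      exact absurd (hvec p 0 (by rw [← hg, smul_zero])) (Nat.not_lt_zero _)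
    | some ⟨k, c⟩, some ⟨k', c'⟩ =>
      simp only [Option.elim] at hg
      have h1 := hvec ⟨k, c⟩ (k' + 1) (by rw [← hg, hsmul, hvec' ⟨k', c'⟩, smul_zero])
      have h2 := hvec ⟨k', c'⟩ (k + 1) (by
        have := hvec' ⟨k, c⟩
        rwa [← hg, hsmul, smul_eq_zero_iff_eq] at this)
      obtain rfl : k = k' := Fin.ext (by simp only at h1 h2; omega)
      have h3 := H.dvd_quadVal_sub (v := g • rep k c') (w := rep k c) (i := 2 * ℓ - 1 - k)
        (by rw [hsmul]; exact hg)
      rw [quadVal_unitary_smul, show (2 * nilDeg R - (2 * ℓ - 1 - k) + 1) / 2 = k / 2 + 1 by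
        omega] at h3
      have h4 : c' = c := Subtype.ext (by
        rw [← hval, ← hval, Ideal.Quotient.eq, Ideal.mem_span_singleton]
        exact h3)
      rw [h4]
  have hsurj : Function.Surjective Φ := by
    intro o
    induction o using Quotient.inductionOn' with
    | h v =>
    by_cases hv : v = 0
    · exact ⟨none, by rw [hv]; rfl⟩
    obtain ⟨i, hi, w, hw, rfl⟩ := H.exists_isPrimitiveVec_of_ne_zero hv
    let k : Fin (2 * ℓ) := ⟨2 * ℓ - 1 - i, by omega⟩
    have hki : 2 * ℓ - 1 - (k : ℕ) = i := by simp only [k]; omega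
    let c : T k := ⟨Ideal.Quotient.mk _ (quadVal h w), w, hw, rfl⟩
    have h1 := hval k c
    rw [Ideal.Quotient.eq, Ideal.mem_span_singleton] at h1
    obtain ⟨g, hg⟩ := H.exists_smul_unif_pow_smul_eq (hrep k c) hw (Nat.succ_ne_zero _)
      (i := i) (by omega) h1
    refine ⟨some ⟨k, c⟩, Quotient.sound ⟨g, ?_⟩⟩
    simp only [Option.elim, vec, hki]
    exact hg
  have hcard : ∀ k : Fin (2 * ℓ), Nat.card (T k) =
      Nat.card (primRes h) * Nat.card (ResidueField R) ^ ((k : ℕ) / 2) := fun k =>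
    H.card_primVal (by have := k.2; omega)
  have (k : Fin (2 * ℓ)) : Finite (R ⧸ Ideal.span ({x ^ ((k : ℕ) / 2 + 1)} : Set R)) :=
    Finite.of_surjective _ Ideal.Quotient.mk_surjective
  have (k : Fin (2 * ℓ)) : Finite (T k) := inferInstance
  rw [← Nat.card_congr (Equiv.ofBijective Φ ⟨hinj, hsurj⟩), Finite.card_option, Nat.card_sigma]
  simp only [hcard]
  rw [← Finset.mul_sum, Fin.sum_univ_eq_sum_range (fun k => Nat.card (ResidueField R) ^ (k / 2))]
  -- The exponent `i` arises from both `k = 2i` and `k = 2i + 1`.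
  have hsum : ∀ n q : ℕ, ∑ k ∈ Finset.range (2 * n), q ^ (k / 2) =
      2 * ∑ i ∈ Finset.range n, q ^ i := by
    intro n q
    induction n with
    | zero => simp
    | succ n ih =>
      rw [show 2 * (n + 1) = 2 * n + 1 + 1 by ring, Finset.sum_range_succ, Finset.sum_range_succ,
        ih, Finset.sum_range_succ, show (2 * n + 1) / 2 = n by omega,
        show 2 * n / 2 = n by omega]
      ring
  rw [hsum]
  ring

end IsNondegHerm

end Counting

/-! ### Values of diagonal quadratic forms over the residue field -/

section ResidueValues

theorem exists_mul_sq_add_mul_sq_eq {F : Type*} [Field F] [Finite F] (h2 : (2 : F) ≠ 0) {a b : F}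
    (ha : a ≠ 0) (hb : b ≠ 0) (c : F) : ∃ s t, a * s ^ 2 + b * t ^ 2 = c := by
  have := Fintype.ofFinite F
  have hchar : ringChar F ≠ 2 := by
    intro h0
    have h1 : ((ringChar F : ℕ) : F) = 0 := ringChar.Nat.cast_ringChar
    rw [h0] at h1
    exact h2 (by exact_mod_cast h1)
  open Polynomial in
  obtain ⟨s, t, hst⟩ := FiniteField.exists_root_sum_quadratic (R := F)
    (f := C a * X ^ 2 + C 0 * X + C 0) (g := C b * X ^ 2 + C 0 * X + C (-c))
    (degree_quadratic ha) (degree_quadratic hb) (FiniteField.odd_card_of_char_ne_two hchar)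
  refine ⟨s, t, ?_⟩
  simp at hst
  linear_combination hst

/-- Squaring on `Fˣ` has kernel `{1, -1}`, of order two, and scaling by `a` is injective. -/
theorem two_mul_card_mul_sq {F : Type*} [Field F] [Finite F] (h2 : (2 : F) ≠ 0) {a : F}
    (ha : a ≠ 0) :
    2 * Nat.card {c : F | ∃ s, s ≠ 0 ∧ a * s ^ 2 = c} + 1 = Nat.card F := by
  let f : Fˣ →* Fˣ := powMonoidHom 2
  have hker : Nat.card f.ker = 2 := by
    have h1 : (f.ker : Set Fˣ) = {1, -1} := by
      ext u
      simp only [SetLike.mem_coe, MonoidHom.mem_ker, f, powMonoidHom_apply,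
        Set.mem_insert_iff, Set.mem_singleton_iff]
      rw [Units.ext_iff, Units.ext_iff, Units.ext_iff, Units.val_pow_eq_pow_val, Units.val_one,
        Units.val_neg, Units.val_one, sq_eq_one_iff]
    have h3 : Nat.card f.ker = (f.ker : Set Fˣ).ncard := Nat.card_coe_set_eq _
    rw [h3, h1, Set.ncard_pair]
    intro h4
    have h5 := congrArg Units.val h4
    simp only [Units.val_one, Units.val_neg] at h5
    exact h2 (by linear_combination h5)
  have hrange : Nat.card {c : F | ∃ s, s ≠ 0 ∧ a * s ^ 2 = c} = Nat.card f.range := by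
    refine (Nat.card_congr (Equiv.ofBijective (fun u : f.range =>
      (⟨a * (u : Fˣ), ?_⟩ : {c : F | ∃ s, s ≠ 0 ∧ a * s ^ 2 = c})) ⟨?_, ?_⟩)).symm
    · obtain ⟨_, s, rfl⟩ := u
      exact ⟨s, s.ne_zero, by simp [f]⟩
    · intro u v huv
      exact Subtype.ext (Units.ext (mul_left_cancel₀ ha (congrArg Subtype.val huv)))
    · rintro ⟨_, s, hs, rfl⟩
      exact ⟨⟨f (Units.mk0 s hs), _, rfl⟩, Subtype.ext (by simp [f])⟩
  have hmul := f.ker.card_mul_index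
  rw [hker, Subgroup.index_ker, Nat.card_units] at hmul
  rw [hrange, hmul]
  exact Nat.sub_add_cancel Nat.card_pos

variable {R : Type*} [CommRing R] {x : R}
variable {V : Type*} [AddCommGroup V] [Module (Ext R x) V] {h : Form R x V}

theorem form_sum_sum {ι : Type*} [Fintype ι] {r : ι → Rˣ} {b : Module.Basis ι (Ext R x) V}
    (hb : ∀ i, h (b i) (b i) = algebraMap R (Ext R x) (r i))
    (hb' : ∀ i j, i ≠ j → h (b i) (b j) = 0) (c d : ι → Ext R x) :
    h (∑ i, c i • b i) (∑ i, d i • b i) =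
      ∑ i, star (c i) * d i * algebraMap R (Ext R x) (r i) := by
  rw [map_sum h, LinearMap.sum_apply]
  refine Finset.sum_congr rfl fun i _ => ?_
  rw [map_sum, Finset.sum_eq_single i, form_smul_left, form_smul_right, hb, mul_assoc]
  · intro j _ hij
    rw [form_smul_left, form_smul_right, hb' i j hij.symm, mul_zero, mul_zero]
  · simp

theorem quadVal_eq_sum {ι : Type*} [Fintype ι] {r : ι → Rˣ}
    {b : Module.Basis ι (Ext R x) V}
    (hb : ∀ i, h (b i) (b i) = algebraMap R (Ext R x) (r i))
    (hb' : ∀ i j, i ≠ j → h (b i) (b j) = 0) (c : ι → Ext R x) :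
    quadVal h (∑ i, c i • b i) = ∑ i, r i * (c i).norm := by
  rw [quadVal, form_sum_sum hb hb', Finset.sum_congr rfl (g := fun i =>
    algebraMap R (Ext R x) (r i * (c i).norm)), ← map_sum, QuadraticAlgebra.algebraMap_re]
  intro i _
  rw [map_mul, QuadraticAlgebra.algebraMap_norm_eq_mul_star]
  ring

variable [IsLocalRing R]

theorem residue_unit_ne_zero (r : Rˣ) : residue R (r : R) ≠ 0 :=
  (r.isUnit.map (residue R)).ne_zero

/-- An element of `R` that is a square in the residue field is a square. -/
theorem isSquare_of_isSquare_residue [Finite R] (h2 : IsUnit (2 : R))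
    (hx : maximalIdeal R = Ideal.span {x}) {ε : Rˣ} (hε : IsSquare (residue R ε)) :
    IsSquare ε := by
  obtain ⟨t, ht⟩ := hε
  obtain ⟨s, rfl⟩ := residue_surjective t
  rw [← map_mul, residue_eq_residue_iff hx] at ht
  obtain ⟨d, hd⟩ := ht
  have hxu : ¬ IsUnit x := by
    rw [not_isUnit_iff_mem, hx]
    exact Ideal.mem_span_singleton_self x
  have hs : IsUnit s := by
    by_contra hs
    rw [not_isUnit_iff_mem] at hs hxu
    refine (not_isUnit_iff_mem _).mpr ?_ ε.isUnit
    rw [show (ε : R) = s * s + x * d by linear_combination hd]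
    exact add_mem (Ideal.mul_mem_left _ _ hs) (Ideal.mul_mem_right _ _ hxu)
  obtain ⟨s, rfl⟩ := hs
  -- From `ε = s² + x d`, a root `s (1 + x u)` requires `2 u + x u² = d / s²`.
  obtain ⟨u, hu⟩ := exists_two_mul_add_mul_sq h2 hxu (d * ↑s⁻¹ * ↑s⁻¹)
  have hsq : (ε : R) = (s * (1 + x * u)) * (s * (1 + x * u)) := by
    linear_combination hd - s * s * x * hu - (x * d * ↑s⁻¹ * s + x * d) * s.mul_inv
  have hunit : IsUnit (s * (1 + x * u) : R) := isUnit_of_mul_isUnit_left (hsq ▸ ε.isUnit)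
  obtain ⟨w, hw⟩ := hunit
  exact ⟨w, Units.ext (by rw [hsq, Units.val_mul, hw])⟩

namespace IsNondegHerm

theorem residue_two_ne_zero (H : IsNondegHerm h) : (2 : ResidueField R) ≠ 0 := by
  have h1 := (H.two.map (residue R)).ne_zero
  rwa [map_ofNat] at h1

theorem residue_norm (H : IsNondegHerm h) (a : Ext R x) :
    residue R a.norm = residue R a.re ^ 2 := by
  have hxm : residue R x = 0 := by
    rw [residue_eq_zero_iff, H.span]
    exact Ideal.mem_span_singleton_self x
  rw [QuadraticAlgebra.norm_def, map_sub, map_add]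
  simp [pow_two, hxm]

/-- Norms reduce to squares, since `x` vanishes in the residue field, and a vector is primitive
exactly when its reduction modulo `y` is non-zero. -/
theorem mem_primRes_iff (H : IsNondegHerm h) {ι : Type*} [Fintype ι] {r : ι → Rˣ}
    (hr : HasType h r) (c : ResidueField R) :
    c ∈ primRes h ↔ ∃ a : ι → ResidueField R, a ≠ 0 ∧ ∑ i, residue R (r i) * a i ^ 2 = c := by
  obtain ⟨b, hb, hb'⟩ := hr
  constructor
  · rintro ⟨v, ⟨w, hw⟩, rfl⟩
    refine ⟨fun i => residue R (b.repr v i).re, fun h0 => ?_, ?_⟩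
    · have h1 (i) : ∃ d, b.repr v i = unif x * d := by
        refine exists_eq_unif_mul H.span ?_
        rw [isUnit_ext_iff H.span, not_isUnit_iff_mem, ← residue_eq_zero_iff]
        exact congrFun h0 i
      choose d hd using h1
      rw [← b.sum_repr v] at hw
      simp only [hd, mul_smul, ← Finset.smul_sum, form_smul_right] at hw
      exact not_isUnit_unif_mul H.span _ hw
    · conv_rhs => rw [← b.sum_repr v]
      rw [quadVal_eq_sum hb hb', map_sum]
      simp only [map_mul, H.residue_norm]
  · rintro ⟨a, ha, rfl⟩
    choose s hs using fun i => residue_surjective (a i)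
    obtain ⟨i, hi⟩ := Function.ne_iff.mp ha
    refine ⟨∑ i, algebraMap R (Ext R x) (s i) • b i, ?_, ?_⟩
    · refine H.isPrimitiveVec_of_isUnit_repr b (i := i) ?_
      rw [b.repr_sum_self, isUnit_ext_iff H.span, QuadraticAlgebra.algebraMap_re]
      by_contra hu
      rw [not_isUnit_iff_mem, ← residue_eq_zero_iff, hs] at hu
      exact hi hu
    · rw [quadVal_eq_sum hb hb', map_sum]
      simp only [map_mul, H.residue_norm, QuadraticAlgebra.algebraMap_re, hs]

theorem card_primRes_hyperbolic (H : IsNondegHerm h) (hr : HasType h ![1, -1]) :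
    Nat.card (primRes h) = Nat.card (ResidueField R) := by
  have hS : primRes h = Set.univ := by
    refine Set.eq_univ_of_forall fun c => ?_
    rw [H.mem_primRes_iff hr]
    have h2 := H.residue_two_ne_zero
    -- Solves `a - b = 1`, `a + b = c`; the first equation keeps the vector non-zero even for `c =
    -- 0`.
    refine ⟨![(c + 1) / 2, (c - 1) / 2], fun h0 => ?_, ?_⟩
    · have h3 : (c + 1) / 2 = 0 := congrFun h0 0
      have h4 : (c - 1) / 2 = 0 := congrFun h0 1
      have h5 : (1 : ResidueField R) = (c + 1) / 2 - (c - 1) / 2 := by field_simp; ring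
      rw [h3, h4, sub_zero] at h5
      exact one_ne_zero h5
    · simp
      field_simp
      ring
  rw [hS, Nat.card_coe_set_eq, Set.ncard_univ]

variable [Finite R]

theorem card_primRes_rank_one (H : IsNondegHerm h) {r : Fin 1 → Rˣ} (hr : HasType h r) :
    2 * Nat.card (primRes h) + 1 = Nat.card (ResidueField R) := by
  rw [← two_mul_card_mul_sq H.residue_two_ne_zero (residue_unit_ne_zero (r 0))]
  have hS : primRes h = {c | ∃ s, s ≠ 0 ∧ residue R (r 0) * s ^ 2 = c} := by
    ext c
    rw [H.mem_primRes_iff hr]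
    constructor
    · rintro ⟨a, ha, hc⟩
      refine ⟨a 0, fun h0 => ha (funext fun i => ?_), by simpa using hc⟩
      rw [Subsingleton.elim i 0, h0, Pi.zero_apply]
    · rintro ⟨s, hs, hc⟩
      exact ⟨fun _ => s, fun h0 => hs (congrFun h0 0), by simpa using hc⟩
  rw [hS]

/-- A non-square unit stays a non-square in the residue field, so the reduced form is anisotropic
and misses zero; a binary form represents all the rest. -/
theorem card_primRes_anisotropic (H : IsNondegHerm h) {ε : Rˣ} (hε : ¬ IsSquare ε)
    (hr : HasType h ![1, -ε]) : Nat.card (primRes h) + 1 = Nat.card (ResidueField R) := by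
  have hS : primRes h = {0}ᶜ := by
    ext c
    rw [H.mem_primRes_iff hr, Set.mem_compl_singleton_iff]
    constructor
    · rintro ⟨a, ha, rfl⟩ h0
      simp only [Fin.sum_univ_two, Matrix.cons_val_zero, Matrix.cons_val_one,
        Units.val_one, Units.val_neg, map_one, map_neg, one_mul] at h0
      have h1 : a 1 ≠ 0 := by
        intro h1
        rw [h1] at h0
        have h2 : a 0 = 0 := by
          refine pow_eq_zero_iff two_ne_zero |>.mp ?_
          linear_combination h0
        exact ha (funext fun i => by fin_cases i <;> assumption)
      refine hε (isSquare_of_isSquare_residue H.two H.span ⟨a 0 / a 1, ?_⟩)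
      field_simp
      linear_combination -h0
    · intro hc
      obtain ⟨s, t, hst⟩ := exists_mul_sq_add_mul_sq_eq H.residue_two_ne_zero
        (residue_unit_ne_zero (1 : Rˣ)) (residue_unit_ne_zero (-ε)) c
      refine ⟨![s, t], fun h0 => hc ?_, by simpa using hst⟩
      have h1 : s = 0 := congrFun h0 0
      have h2 : t = 0 := congrFun h0 1
      rw [← hst, h1, h2]
      ring
  have h1 := Set.ncard_add_ncard_compl ({0} : Set (ResidueField R))
  rw [Set.ncard_singleton] at h1
  rw [hS, Nat.card_coe_set_eq, ← h1, add_comm]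

theorem card_primRes_of_three_le (H : IsNondegHerm h) {n : ℕ} {r : Fin (n + 3) → Rˣ}
    (hr : HasType h r) : Nat.card (primRes h) = Nat.card (ResidueField R) := by
  have hS : primRes h = Set.univ := by
    refine Set.eq_univ_of_forall fun c => ?_
    rw [H.mem_primRes_iff hr]
    obtain ⟨s, t, hst⟩ := exists_mul_sq_add_mul_sq_eq H.residue_two_ne_zero
      (residue_unit_ne_zero (r 0)) (residue_unit_ne_zero (r 1)) (c - residue R (r 2))
    -- The third coordinate is fixed at one to keep the vector non-zero; the first two make up the
    -- value.
    refine ⟨Fin.cons s (Fin.cons t (Fin.cons 1 0)), fun h0 => ?_, ?_⟩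
    · exact one_ne_zero (congrFun h0 2)
    · rw [Fin.sum_univ_succ, Fin.sum_univ_succ, Fin.sum_univ_succ]
      simp only [Fin.cons_zero, Fin.cons_succ, Pi.zero_apply]
      rw [Finset.sum_eq_zero (by simp)]
      simp only [Fin.succ_zero_eq_one, Fin.succ_one_eq_two]
      linear_combination hst
  rw [hS, Nat.card_coe_set_eq, Set.ncard_univ]

end IsNondegHerm

end ResidueValues

/-! ### Intertwining operators and a permuted basis of the endomorphism algebra -/

section PermutedBasis

variable {G V X : Type*} [Group G] [MulAction G V] [AddCommGroup X] [Module ℂ X]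
  {ρ : Representation ℂ G X} (b : Module.Basis V ℂ (Module.End ℂ X))

/-- Conjugation by `ρ g` fixes `f` and permutes the basis, so coefficients are constant on orbits.
-/
theorem repr_smul_eq_of_intertwining [Finite V] (hb : ∀ g v, ρ g * b v = b (g • v) * ρ g)
    (f : IntertwiningMap ρ ρ) (g : G) (v : V) :
    b.repr f.toLinearMap (g • v) = b.repr f.toLinearMap v := by
  have := Fintype.ofFinite V
  set c := b.repr f.toLinearMap with hc
  have h1 : ∑ v, c v • b v = f.toLinearMap := b.sum_repr _
  have h2 : f.toLinearMap * ρ g = ρ g * f.toLinearMap := f.isIntertwining' g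
  have h3 : (∑ v, c v • b v) * ρ g = (∑ v, c v • b (g • v)) * ρ g := by
    conv_lhs => rw [h1, h2, ← h1]
    simp only [Finset.mul_sum, Finset.sum_mul, mul_smul_comm, smul_mul_assoc, hb]
  have hg : ρ g * ρ g⁻¹ = 1 := by rw [← map_mul, mul_inv_cancel, map_one]
  have h4 : ∑ v, c v • b v = ∑ v, c v • b (g • v) := by
    have := congrArg (· * ρ g⁻¹) h3
    simpa only [mul_assoc, hg, mul_one] using this
  have h5 : ∑ v, c v • b (g • v) = ∑ v, c (g⁻¹ • v) • b v := by
    rw [← Equiv.sum_comp (MulAction.toPerm g) (fun v => c (g⁻¹ • v) • b v)]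
    simp
  have h6 := congrArg (fun T => b.repr T (g • v)) (h4.trans h5)
  simp only [b.repr_sum_self, inv_smul_smul] at h6
  exact h6

/-- If a group permutes a basis of `End X` by conjugation, then the dimension of the algebra of
intertwining operators is the number of orbits. -/
theorem finrank_intertwiningMap_eq_card_orbits [Finite V]
    (hb : ∀ g v, ρ g * b v = b (g • v) * ρ g) :
    Module.finrank ℂ (IntertwiningMap ρ ρ) = Nat.card (MulAction.orbitRel.Quotient G V) := by
  classical
  have := Fintype.ofFinite V
  have := Fintype.ofFinite (MulAction.orbitRel.Quotient G V)
  let π : V → MulAction.orbitRel.Quotient G V := Quotient.mk''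
  have hπ (g : G) (v : V) : π (g • v) = π v := Quotient.sound ⟨g, rfl⟩
  let Ψ : (MulAction.orbitRel.Quotient G V → ℂ) →ₗ[ℂ] IntertwiningMap ρ ρ :=
    { toFun := fun c => ⟨∑ v, c (π v) • b v, fun g => by
        change (∑ v, c (π v) • b v) * ρ g = ρ g * ∑ v, c (π v) • b v
        simp only [Finset.mul_sum, Finset.sum_mul, mul_smul_comm, smul_mul_assoc, hb]
        rw [← Equiv.sum_comp (MulAction.toPerm g)]
        simp only [MulAction.toPerm_apply, hπ]⟩
      map_add' := fun c d => IntertwiningMap.ext (by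
        simp only [Pi.add_apply, add_smul, Finset.sum_add_distrib]
        rfl)
      map_smul' := fun a c => IntertwiningMap.ext (by
        simp only [Pi.smul_apply, smul_assoc, ← Finset.smul_sum]
        rfl) }
  have hΨ (c) : (Ψ c).toLinearMap = ∑ v, c (π v) • b v := rfl
  have hbij : Function.Bijective Ψ := by
    constructor
    · intro c d hcd
      funext o
      induction o using Quotient.inductionOn' with
      | h v =>
      have h1 := congrArg (fun T => b.repr T.toLinearMap v) hcd
      simp only [hΨ, b.repr_sum_self] at h1
      exact h1
    · intro f
      refine ⟨fun o => Quotient.liftOn' o (b.repr f.toLinearMap) ?_, IntertwiningMap.ext ?_⟩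
      · rintro _ v ⟨g, rfl⟩
        exact repr_smul_eq_of_intertwining b hb f g v
      · rw [hΨ]
        exact b.sum_repr _
  rw [← (LinearEquiv.ofBijective Ψ hbij).finrank_eq, Module.finrank_fintype_fun_eq_card,
    Nat.card_eq_fintype_card]

/-- Gelfand's criterion: if a permutation of the basis that preserves all orbits reverses
products, then the intertwining operators commute. -/
theorem intertwiningMap_mul_comm [Finite V] (hb : ∀ g v, ρ g * b v = b (g • v) * ρ g)
    (s : Equiv.Perm V) (hs : ∀ v, ∃ g : G, s v = g • v)
    (hmul : ∀ v w, b.constr ℂ (b ∘ s) (b v * b w) = b (s w) * b (s v))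
    (f f' : IntertwiningMap ρ ρ) : f * f' = f' * f := by
  have := Fintype.ofFinite V
  set L := b.constr ℂ (b ∘ s) with hL
  -- `L` moves basis vectors only within orbits, where the coefficients of `f` are constant. As `L`
  -- also reverses products, `f f' = L (f f') = L f' L f = f' f`.
  have hfix (f : IntertwiningMap ρ ρ) : L f.toLinearMap = f.toLinearMap := by
    conv_lhs => rw [← b.sum_repr f.toLinearMap]
    conv_rhs => rw [← b.sum_repr f.toLinearMap, ← Equiv.sum_comp s]
    rw [map_sum]
    refine Finset.sum_congr rfl fun v _ => ?_
    obtain ⟨g, hg⟩ := hs v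
    rw [map_smul, hL, b.constr_basis, Function.comp_apply]
    congr 1
    rw [hg, repr_smul_eq_of_intertwining b hb]
  have hanti (S T : Module.End ℂ X) : L (S * T) = L T * L S := by
    rw [← b.sum_repr S, ← b.sum_repr T]
    simp only [Finset.mul_sum, Finset.sum_mul, mul_smul_comm, smul_mul_assoc, map_sum, map_smul,
      hmul, Finset.smul_sum]
    rw [Finset.sum_comm]
    refine Finset.sum_congr rfl fun v _ => Finset.sum_congr rfl fun w _ => ?_
    simp only [hL, b.constr_basis, Function.comp_apply]
    rw [smul_comm]
  have hcoe (f f' : IntertwiningMap ρ ρ) :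
      (f * f').toLinearMap = f.toLinearMap * f'.toLinearMap := rfl
  refine IntertwiningMap.ext ?_
  rw [← hfix (f * f'), hcoe, hanti, hfix, hfix, hcoe]

/-- Up to a scalar `C` is the inverse of `A`, so `B` is conjugate to `χ B`. -/
theorem trace_eq_zero_of_mul_eq_smul {A B C : Module.End ℂ X} {χ c : ℂ} (hχ : χ ≠ 1) (hc : c ≠ 0)
    (hAB : A * B = χ • (B * A)) (hAC : A * C = c • 1) (hCA : C * A = c • 1) :
    LinearMap.trace ℂ X B = 0 := by
  have h1 := LinearMap.trace_mul_comm ℂ (A * B) C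
  rw [← mul_assoc, hCA, hAB, smul_mul_assoc, mul_assoc, hAC, smul_mul_assoc, one_mul,
    mul_smul_comm, mul_one, map_smul, map_smul, smul_eq_mul, smul_eq_mul] at h1
  have h2 : (χ - 1) * LinearMap.trace ℂ X B = 0 := by
    refine mul_left_cancel₀ hc ?_
    linear_combination h1
  exact (mul_eq_zero.mp h2).resolve_left (sub_ne_zero.mpr hχ)

/-- A representation with commuting intertwining operators is multiplicity free. -/
theorem constituents_of_intertwiningMap_mul_comm [Finite G] [FiniteDimensional ℂ X]
    (hcomm : ∀ f g : IntertwiningMap ρ ρ, f * g = g * f) :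
    numConstituents ρ = Module.finrank ℂ (IntertwiningMap ρ ρ) ∧
    Module.length (MonoidAlgebra ℂ G) ρ.asModule = Module.finrank ℂ (IntertwiningMap ρ ρ) := by
  have : FiniteDimensional ℂ ρ.asModule := Module.Finite.equiv ρ.asModuleEquiv.symm
  let e := IntertwiningMap.equivAlgEnd ρ
  have hend : ∀ f g : Module.End (MonoidAlgebra ℂ G) ρ.asModule, f * g = g * f := by
    intro f g
    apply e.symm.injective
    rw [map_mul, map_mul, hcomm]
  rw [e.toLinearEquiv.finrank_eq]
  exact ⟨card_simpleIso_eq_card_isotypicComponents.trans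
    (card_isotypicComponents_eq_finrank_end ℂ hend), length_eq_finrank_end_of_commute ℂ hend⟩

/-- The constituents of a representation whose conjugation action permutes a basis of `End X` that
multiplies like a twisted group algebra. -/
theorem constituents_of_twisted_basis {G V X : Type*} [Group G] [Finite G] [AddCommGroup V]
    [Finite V] [MulAction G V] [AddCommGroup X] [Module ℂ X] [FiniteDimensional ℂ X]
    {ρ : Representation ℂ G X} (b : Module.Basis V ℂ (Module.End ℂ X))
    (hperm : ∀ g v, ρ g * b v = b (g • v) * ρ g) {β : V → V → ℂ}
    (hmul : ∀ v w, b v * b w = β v w • b (v + w)) (s : Equiv.Perm V)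
    (hadd : ∀ v w, s (v + w) = s v + s w) (hβ : ∀ v w, β (s v) (s w) = β w v)
    (hs : ∀ v, ∃ g : G, s v = g • v) :
    numConstituents ρ = Nat.card (MulAction.orbitRel.Quotient G V) ∧
    Module.length (MonoidAlgebra ℂ G) ρ.asModule = Nat.card (MulAction.orbitRel.Quotient G V) := by
  rw [← finrank_intertwiningMap_eq_card_orbits b hperm]
  refine constituents_of_intertwiningMap_mul_comm (intertwiningMap_mul_comm b hperm s hs
    fun v w => ?_)
  rw [hmul, hmul, map_smul, b.constr_basis, Function.comp_apply, hβ, hadd, add_comm (s v)]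

end PermutedBasis

/-! ### The Schrödinger module of the Heisenberg group -/

section Schrodinger

variable {R : Type*} [CommRing R] {x : R}
variable {V : Type*} [AddCommGroup V] [Module (Ext R x) V] (h : Form R x V)

/-- The embedding of `A` as central subgroup of `H ⋊ U`. -/
def centralElt (a : Ext R x) : HU h := SemidirectProduct.inl ⟨a, 0⟩

theorem centralElt_mul (a : Ext R x) (k : HU h) : centralElt h a * k = k * centralElt h a := by
  refine SemidirectProduct.ext (Heis.ext ?_ ?_) ?_
  · change a + k.left.fst + h 0 k.left.snd = k.left.fst + a + h k.left.snd (k.right.1 0)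
    rw [map_zero, map_zero, map_zero, LinearMap.zero_apply, add_comm a]
  · change 0 + k.left.snd = k.left.snd + k.right.1 0
    rw [map_zero, zero_add, add_zero]
  · change 1 * k.right = k.right * 1
    rw [one_mul, mul_one]

theorem inl_eq_centralElt_mul (n : Heis h) :
    (SemidirectProduct.inl n : HU h) = centralElt h n.fst * SemidirectProduct.inl ⟨0, n.snd⟩ := by
  rw [centralElt, ← map_mul]
  congr 1
  refine Heis.ext ?_ ?_ <;> simp

variable [IsLocalRing R] [Finite R]
variable (hx : maximalIdeal R = Ideal.span {x}) (lam : AddChar R ℂ)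

/-- The image of `k ⊗ 1` in the induced module. -/
def indVec (k : HU h) : IndV (indSubgroup h).subtype (indZ hx h lam) :=
  IndV.mk (indSubgroup h).subtype (indZ hx h lam) k 1

theorem bigX_indVec (g k : HU h) :
    bigX hx h lam g (indVec h hx lam k) = indVec h hx lam (k * g⁻¹) :=
  ind_mk _ _ _ _ _

theorem indVec_mul (s : indSubgroup h) (k : HU h) :
    indChar hx h lam s • indVec h hx lam (s * k) = indVec h hx lam k := by
  have h1 := Coinvariants.mk_self_apply
    (Representation.tprod ((leftRegular ℂ (HU h)).comp (indSubgroup h).subtype) (indZ hx h lam))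
    s (MonoidAlgebra.single k 1 ⊗ₜ[ℂ] 1)
  refine Eq.trans ?_ h1
  rw [indVec, ← map_smul]
  simp [indZ, IndV.mk]
  rfl

theorem bigX_apply_subgroup (s : indSubgroup h) :
    bigX hx h lam s (indVec h hx lam 1) = indChar hx h lam s • indVec h hx lam 1 := by
  rw [bigX_indVec, one_mul, ← indVec_mul h hx lam s, mul_inv_cancel]

/-- The inverse character, extended by zero off the subgroup, is compatible with the coinvariant
relations and gives a functional with value one at this vector. -/
theorem indVec_one_ne_zero : indVec h hx lam 1 ≠ 0 := by
  classical
  let φ : HU h → ℂ := fun k =>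
    if hk : k ∈ indSubgroup h then indChar hx h lam (⟨k, hk⟩)⁻¹ else 0
  let F : TensorProduct ℂ (MonoidAlgebra ℂ (HU h)) ℂ →ₗ[ℂ] ℂ :=
    TensorProduct.lift ((Finsupp.lift _ _ _ fun k => φ k • LinearMap.id) ∘ₗ
      (MonoidAlgebra.coeffLinearEquiv ℂ).toLinearMap)
  have hF (k : HU h) (a c : ℂ) : F (MonoidAlgebra.single k a ⊗ₜ[ℂ] c) = a * φ k * c := by
    simp [F, mul_assoc]
  let Φ : IndV (indSubgroup h).subtype (indZ hx h lam) →ₗ[ℂ] ℂ := Coinvariants.lift _ F (by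
    intro s
    refine TensorProduct.ext (MonoidAlgebra.lhom_ext' fun k => LinearMap.ext_ring
      (LinearMap.ext_ring ?_))
    have h1 : F (MonoidAlgebra.single ((s : HU h) * k) 1 ⊗ₜ[ℂ] (indChar hx h lam s)) =
        F (MonoidAlgebra.single k 1 ⊗ₜ[ℂ] 1) := by
      rw [hF, hF, one_mul, one_mul, mul_one]
      by_cases hk : k ∈ indSubgroup h
      · have hsk : (s : HU h) * k ∈ indSubgroup h := mul_mem s.2 hk
        simp only [φ, dif_pos hk, dif_pos hsk]
        rw [← map_mul]
        congr 1
        rw [show (⟨(s : HU h) * k, hsk⟩ : indSubgroup h) = s * ⟨k, hk⟩ from rfl, mul_inv_rev,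
          inv_mul_cancel_right]
      · have hsk : (s : HU h) * k ∉ indSubgroup h := fun hsk =>
          hk ((Subgroup.mul_mem_cancel_left _ s.2).mp hsk)
        simp only [φ, dif_neg hk, dif_neg hsk, zero_mul]
    simpa [indZ] using h1)
  intro h0
  have h1 : Φ (indVec h hx lam 1) = 1 := by
    have h2 : Φ (indVec h hx lam 1) = F (MonoidAlgebra.single 1 1 ⊗ₜ[ℂ] 1) := rfl
    rw [h2, hF]
    simp only [φ, dif_pos (one_mem (indSubgroup h))]
    rw [show (⟨1, one_mem (indSubgroup h)⟩ : indSubgroup h) = 1 from rfl, inv_one, map_one]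
    norm_num
  rw [h0, map_zero] at h1
  exact zero_ne_one h1

theorem span_indVec : Submodule.span ℂ (Set.range (indVec h hx lam)) = ⊤ := by
  rw [← Submodule.ker_mkQ (Submodule.span ℂ (Set.range (indVec h hx lam))), LinearMap.ker_eq_top]
  refine IndV.hom_ext _ _ fun k => LinearMap.ext_ring ?_
  rw [LinearMap.zero_comp, LinearMap.zero_apply, LinearMap.comp_apply, Submodule.mkQ_apply,
    Submodule.Quotient.mk_eq_zero]
  exact Submodule.subset_span ⟨k, rfl⟩

theorem bigX_centralElt (a : Ext R x) :
    bigX hx h lam (centralElt h a) = mu x lam a • (1 : Module.End ℂ _) := by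
  refine LinearMap.ext_on_range (span_indVec h hx lam) fun k => ?_
  have hmem : centralElt h a ∈ indSubgroup h := (V₀ x V).zero_mem
  have h1 := indVec_mul h hx lam ⟨_, hmem⟩ (k * (centralElt h a)⁻¹)
  rw [bigX_indVec, LinearMap.smul_apply, Module.End.one_apply, ← h1, ← mul_assoc,
    centralElt_mul, mul_inv_cancel_right]
  rfl

/-- The operator on `X` attached to a vector `v`. -/
def heisOp (v : V) : Module.End ℂ (IndV (indSubgroup h).subtype (indZ hx h lam)) :=
  bigX hx h lam (SemidirectProduct.inl ⟨0, v⟩)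

theorem bigX_inl (n : Heis h) :
    bigX hx h lam (SemidirectProduct.inl n) = mu x lam n.fst • heisOp h hx lam n.snd := by
  rw [inl_eq_centralElt_mul, map_mul, bigX_centralElt, smul_mul_assoc, one_mul, heisOp]

theorem heisOp_mul (v w : V) :
    heisOp h hx lam v * heisOp h hx lam w = mu x lam (h v w) • heisOp h hx lam (v + w) := by
  rw [heisOp, heisOp, ← map_mul, ← map_mul, bigX_inl]
  simp

theorem heisOp_zero : heisOp h hx lam 0 = 1 := (bigX hx h lam).map_one

theorem heisOp_mul_neg (w : V) :
    heisOp h hx lam w * heisOp h hx lam (-w) = mu x lam (-h w w) • (1 : Module.End ℂ _) := by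
  rw [heisOp_mul, add_neg_cancel w, map_neg (h w), heisOp_zero]

theorem heisOp_neg_mul (w : V) :
    heisOp h hx lam (-w) * heisOp h hx lam w = mu x lam (-h w w) • (1 : Module.End ℂ _) := by
  rw [heisOp_mul, neg_add_cancel w, map_neg h w, LinearMap.neg_apply, heisOp_zero]

theorem heisOp_commutation (w v : V) :
    heisOp h hx lam w * heisOp h hx lam v =
      mu x lam (h w v - h v w) • (heisOp h hx lam v * heisOp h hx lam w) := by
  rw [heisOp_mul, heisOp_mul, smul_smul, ← AddChar.map_add_eq_mul, sub_add_cancel, add_comm w]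

theorem weilRep_mul_heisOp (g : unitaryGrp h) (v : V) :
    weilRep hx h lam g * heisOp h hx lam v = heisOp h hx lam (g • v) * weilRep hx h lam g := by
  have h1 : (SemidirectProduct.inr g * SemidirectProduct.inl ⟨0, v⟩ : HU h) =
      SemidirectProduct.inl ⟨0, g • v⟩ * SemidirectProduct.inr g := by
    have h2 := SemidirectProduct.inl_aut (φ := heisAct h) g ⟨0, v⟩
    rw [show (⟨0, g • v⟩ : Heis h) = heisAct h g ⟨0, v⟩ from rfl, h2, map_inv,
      inv_mul_cancel_right]
  change bigX hx h lam _ * bigX hx h lam _ = bigX hx h lam _ * bigX hx h lam _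
  rw [← map_mul, h1, map_mul]

theorem heisOp_indVec_one {z : V} (hz : z ∈ V₀ x V) :
    heisOp h hx lam z (indVec h hx lam 1) = indVec h hx lam 1 := by
  have hmem : (SemidirectProduct.inl ⟨0, z⟩ : HU h) ∈ indSubgroup h := hz
  refine (bigX_apply_subgroup h hx lam ⟨_, hmem⟩).trans ?_
  have h1 : indChar hx h lam ⟨_, hmem⟩ = 1 := (mu x lam).map_zero_eq_one
  rw [h1, one_smul]

/-- Bounds `dim X` by `|V / V₀|`. The vector `indVec 1` is fixed by `U` and by `(0, V₀)`, and `A`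
acts by scalars, so its translate by `v` depends, up to a scalar, only on the coset of `v`. -/
theorem span_heisOp_indVec :
    Submodule.span ℂ (Set.range fun c : V ⧸ V₀ x V =>
      heisOp h hx lam (Quotient.out c) (indVec h hx lam 1)) = ⊤ := by
  rw [eq_top_iff, ← span_indVec h hx lam, Submodule.span_le]
  rintro _ ⟨k, rfl⟩
  set W := Submodule.span ℂ (Set.range fun c : V ⧸ V₀ x V =>
      heisOp h hx lam (Quotient.out c) (indVec h hx lam 1)) with hW
  have h1 : indVec h hx lam k = bigX hx h lam k⁻¹ (indVec h hx lam 1) := by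
    rw [bigX_indVec, one_mul, inv_inv]
  have hU (u : unitaryGrp h) : bigX hx h lam (SemidirectProduct.inr u) (indVec h hx lam 1) =
      indVec h hx lam 1 := by
    have hmem : (SemidirectProduct.inr u : HU h) ∈ indSubgroup h := (V₀ x V).zero_mem
    refine (bigX_apply_subgroup h hx lam ⟨_, hmem⟩).trans ?_
    have h1 : indChar hx h lam ⟨_, hmem⟩ = 1 := (mu x lam).map_zero_eq_one
    rw [h1, one_smul]
  rw [SetLike.mem_coe, h1, ← SemidirectProduct.inl_left_mul_inr_right k⁻¹, map_mul,
    Module.End.mul_apply, hU, bigX_inl, LinearMap.smul_apply]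
  refine Submodule.smul_mem _ _ ?_
  generalize (k⁻¹).left.snd = v
  set s : V := Quotient.out (Submodule.Quotient.mk v : V ⧸ V₀ x V) with hs
  have hz : v - s ∈ V₀ x V := by
    rw [← Submodule.Quotient.eq, hs]
    exact (Quotient.out_eq _).symm
  have h2 := heisOp_mul h hx lam s (v - s)
  rw [add_sub_cancel] at h2
  have h3 := congrArg (fun T => T (indVec h hx lam 1)) h2
  simp only [Module.End.mul_apply, heisOp_indVec_one h hx lam hz, LinearMap.smul_apply] at h3
  have h4 : IsUnit (mu x lam (h s (v - s))) := AddChar.val_isUnit _ _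
  have h5 : heisOp h hx lam s (indVec h hx lam 1) ∈ W := Submodule.subset_span ⟨_, rfl⟩
  rw [h3] at h5
  exact (Submodule.smul_mem_iff _ h4.ne_zero).mp h5

end Schrodinger

/-! ### The Heisenberg operators as a basis, and the constituents -/

section Commutant

variable {R : Type*} [CommRing R] [IsLocalRing R] {x : R}
variable {V : Type*} [AddCommGroup V] [Module (Ext R x) V]

theorem mem_V₀_iff {z : V} : z ∈ V₀ x V ↔ ∃ w, unif x ^ nilDeg R • w = z := by
  rw [V₀, idealI, Ideal.span_singleton_pow, Submodule.ideal_span_singleton_smul,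
    Submodule.mem_smul_pointwise_iff_exists]
  simp

namespace IsNondegHerm

variable {h : Form R x V}

/-- The commutator pairing of the Heisenberg group is non-degenerate. -/
theorem exists_mu_ne_one (H : IsNondegHerm h) {lam : AddChar R ℂ} (hlam : lam.IsPrimitive) {v : V}
    (hv : v ≠ 0) : ∃ w, mu x lam (h w v - h v w) ≠ 1 := by
  by_contra! hall
  refine hv (H.eq_zero_of_form_eq_zero fun w => ?_)
  -- Replacing `w` by `s w` with `s ∈ R` makes the pairing `lam (4 s Im h(w, v))`, so primitivity
  -- applies. Replacing `w` by `y w` later turns the real part into an imaginary part.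
  have him (w : V) : (h w v).im = 0 := by
    by_contra hne
    have h4 : (4 : R) * (h w v).im ≠ 0 := by
      intro h0
      rw [show (4 : R) = 2 * 2 by norm_num, mul_assoc] at h0
      exact hne (H.two.mul_right_eq_zero.mp (H.two.mul_right_eq_zero.mp h0))
    refine hlam h4 (DFunLike.ext _ _ fun s => ?_)
    rw [AddChar.mulShift_apply, AddChar.one_apply, ← hall (algebraMap R (Ext R x) s • w)]
    change _ = lam (2 * (h (algebraMap R (Ext R x) s • w) v -
      h v (algebraMap R (Ext R x) s • w)).im)
    congr 1
    rw [form_smul_left, form_smul_right, star_algebraMap, H.herm w v, QuadraticAlgebra.im_sub]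
    simp
    ring
  rw [H.herm w v, star_eq_zero]
  have hre := him (unif x • w)
  rw [form_smul_left, star_unif] at hre
  ext
  · simpa using hre
  · exact him w

variable [Finite R]

theorem finite_indV (H : IsNondegHerm h) [Finite V] (lam : AddChar R ℂ) :
    Module.Finite ℂ (IndV (indSubgroup h).subtype (indZ H.span h lam)) := by
  have : Finite (V ⧸ V₀ x V) := Finite.of_surjective _ (Submodule.mkQ_surjective (V₀ x V))
  exact ⟨Submodule.fg_def.mpr ⟨_, Set.finite_range _, span_heisOp_indVec h H.span lam⟩⟩

theorem trace_heisOp (H : IsNondegHerm h) {lam : AddChar R ℂ} (hlam : lam.IsPrimitive) {v : V} (hv : v ≠ 0) :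
    LinearMap.trace ℂ _ (heisOp h H.span lam v) = 0 := by
  obtain ⟨w, hw⟩ := H.exists_mu_ne_one hlam hv
  exact trace_eq_zero_of_mul_eq_smul hw ((mu x lam).val_isUnit _).ne_zero
    (heisOp_commutation h H.span lam w v) (heisOp_mul_neg h H.span lam w)
    (heisOp_neg_mul h H.span lam w)

/-- Multiplying a relation by `heisOp (-u)` and taking traces isolates the coefficient at `u`. -/
theorem linearIndependent_heisOp (H : IsNondegHerm h) [Finite V] {lam : AddChar R ℂ}
    (hlam : lam.IsPrimitive) :
    LinearIndependent ℂ (heisOp h H.span lam) := by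
  have := Fintype.ofFinite V
  have := H.finite_indV lam
  have : Nontrivial (IndV (indSubgroup h).subtype (indZ H.span h lam)) :=
    ⟨_, _, indVec_one_ne_zero h H.span lam⟩
  rw [Fintype.linearIndependent_iff]
  intro c hc u
  have h1 := congrArg (fun T => LinearMap.trace ℂ _ (heisOp h H.span lam (-u) * T)) hc
  simp only [Finset.mul_sum, mul_smul_comm, heisOp_mul, map_sum, map_smul, mul_zero, map_zero]
    at h1
  rw [Finset.sum_eq_single u] at h1
  · rw [neg_add_cancel, heisOp_zero, LinearMap.trace_one, smul_eq_mul, smul_eq_mul] at h1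
    have h2 : (Module.finrank ℂ (IndV (indSubgroup h).subtype (indZ H.span h lam)) : ℂ) ≠ 0 :=
      Nat.cast_ne_zero.mpr Module.finrank_pos.ne'
    have h3 : mu x lam (h (-u) u) ≠ 0 := ((mu x lam).val_isUnit _).ne_zero
    exact (mul_eq_zero.mp h1).resolve_right (mul_ne_zero h3 h2)
  · intro v _ hvu
    rw [H.trace_heisOp hlam (v := -u + v) (by
      rw [neg_add_eq_sub]; exact sub_ne_zero.mpr hvu), smul_zero, smul_zero]
  · simp

variable [Module.Free (Ext R x) V] [Module.Finite (Ext R x) V]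

/-- Multiplication by `y ^ ℓ` has both image and kernel equal to `V₀`. -/
theorem card_eq_card_quotient_sq (H : IsNondegHerm h) :
    Nat.card V = Nat.card (V ⧸ V₀ x V) ^ 2 := by
  have : Finite V := Module.finite_of_finite (Ext R x)
  let f : V →ₗ[Ext R x] V := LinearMap.lsmul (Ext R x) V (unif x ^ nilDeg R)
  have hf (v : V) : f v = unif x ^ nilDeg R • v := rfl
  have hrange : LinearMap.range f = V₀ x V := by
    ext z
    rw [mem_V₀_iff]
    rfl
  have hker : LinearMap.ker f = V₀ x V := by
    ext z
    rw [LinearMap.mem_ker, mem_V₀_iff, hf]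
    constructor
    · intro hz
      obtain ⟨w, hw⟩ := H.exists_eq_of_unif_pow_smul_eq_zero hz
      exact ⟨w, by rw [hw, two_mul, Nat.add_sub_cancel]⟩
    · rintro ⟨w, rfl⟩
      rw [smul_smul, ← pow_add, unif_pow_eq_zero H.span (by omega), zero_smul]
  have h1 := Nat.card_congr f.quotKerEquivRange.toEquiv
  rw [hrange, hker] at h1
  rw [Submodule.card_eq_card_quotient_mul_card (V₀ x V), ← h1, pow_two]

/-- There is an additive involution of `V` that reverses `h` and preserves all orbits. -/
theorem exists_conjugation (H : IsNondegHerm h) : ∃ s : Equiv.Perm V, (∀ v w, s (v + w) = s v + s w) ∧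
    (∀ v w, h (s v) (s w) = h w v) ∧ ∀ v, ∃ g : unitaryGrp h, s v = g • v := by
  have : Finite V := Module.finite_of_finite (Ext R x)
  obtain ⟨r, b, hb, hb'⟩ := H.exists_hasType
  let s (v : V) : V := ∑ i, star (b.repr v i) • b i
  have hs (v : V) (i) : b.repr (s v) i = star (b.repr v i) := by
    simp only [s, b.repr_sum_self]
  have hinv : Function.Involutive s := fun v => b.ext_elem fun i => by
    rw [hs, hs, star_star]
  refine ⟨hinv.toPerm, fun v w => b.ext_elem fun i => ?_, fun v w => ?_, fun v => ?_⟩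
  · simp [hs]
  · change h (s v) (s w) = h w v
    conv_rhs => rw [← b.sum_repr v, ← b.sum_repr w]
    rw [form_sum_sum hb hb', form_sum_sum hb hb']
    refine Finset.sum_congr rfl fun i _ => ?_
    rw [star_star, mul_comm (b.repr v i)]
  -- The diagonal operator with entries `u i` of norm one is unitary and sends `v` to `s v`; it
  -- depends on `v`.
  · choose u hu huv using fun i => exists_star_eq_mul H.span (b.repr v i)
    obtain ⟨g, hg⟩ := H.exists_unitary (b.constr (Ext R x) fun i => u i • b i) (fun z w => by
      rw [b.constr_apply_fintype (Ext R x), b.constr_apply_fintype (Ext R x)]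
      simp only [b.equivFun_apply, smul_smul]
      conv_rhs => rw [← b.sum_repr z, ← b.sum_repr w]
      rw [form_sum_sum hb hb', form_sum_sum hb hb']
      refine Finset.sum_congr rfl fun i _ => ?_
      rw [star_mul]
      linear_combination (star (b.repr z i) * b.repr w i * algebraMap R (Ext R x) (r i)) * hu i)
    refine ⟨g, ?_⟩
    rw [hg, b.constr_apply_fintype (Ext R x)]
    change s v = _
    simp only [s, huv, b.equivFun_apply, smul_smul]
    exact Finset.sum_congr rfl fun i _ => by rw [mul_comm]

section Basis

variable (H : IsNondegHerm h) {lam : AddChar R ℂ}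

/-- The Heisenberg operators form a basis of `End X`. -/
theorem exists_basis_heisOp (hlam : lam.IsPrimitive) :
    ∃ b : Module.Basis V ℂ (Module.End ℂ (IndV (indSubgroup h).subtype (indZ H.span h lam))),
      ⇑b = heisOp h H.span lam := by
  have : Finite V := Module.finite_of_finite (Ext R x)
  have := Fintype.ofFinite V
  have : Finite (V ⧸ V₀ x V) := Finite.of_surjective _ (Submodule.mkQ_surjective (V₀ x V))
  have := Fintype.ofFinite (V ⧸ V₀ x V)
  have := H.finite_indV lam
  have hli := H.linearIndependent_heisOp hlam
  have hle := finrank_le_of_span_eq_top (span_heisOp_indVec h H.span lam)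
  -- `|V| ≤ dim End X = (dim X)² ≤ |V / V₀|² = |V|`.
  have hcard : Fintype.card V =
      Module.finrank ℂ (Module.End ℂ (IndV (indSubgroup h).subtype (indZ H.span h lam))) := by
    refine le_antisymm hli.fintype_card_le_finrank ?_
    rw [Module.finrank_linearMap, ← Nat.card_eq_fintype_card, H.card_eq_card_quotient_sq,
      Nat.card_eq_fintype_card, pow_two]
    exact Nat.mul_le_mul hle hle
  have : Nonempty V := ⟨0⟩
  exact ⟨basisOfLinearIndependentOfCardEqFinrank hli hcard,
    coe_basisOfLinearIndependentOfCardEqFinrank hli hcard⟩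

theorem constituents_weilRep (hlam : lam.IsPrimitive) :
    numConstituents (weilRep H.span h lam) =
      Nat.card (MulAction.orbitRel.Quotient (unitaryGrp h) V) ∧
    Module.length (MonoidAlgebra ℂ (unitaryGrp h)) (weilRep H.span h lam).asModule =
      Nat.card (MulAction.orbitRel.Quotient (unitaryGrp h) V) := by
  have : Finite V := Module.finite_of_finite (Ext R x)
  have : Finite (V ≃ₗ[Ext R x] V) := DFunLike.finite _
  have := H.finite_indV lam
  obtain ⟨b, hb⟩ := H.exists_basis_heisOp hlam
  obtain ⟨s, hadd, hform, horb⟩ := H.exists_conjugation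
  refine constituents_of_twisted_basis b (fun g v => ?_) (β := fun v w => mu x lam (h v w))
    (fun v w => ?_) s hadd (fun v w => congrArg _ (hform v w)) horb
  · rw [hb]
    exact weilRep_mul_heisOp h H.span lam g v
  · rw [hb]
    exact heisOp_mul h H.span lam v w

end Basis

end IsNondegHerm

end Commutant

end RamifiedWeil

end

/-! ### The main theorem -/

theorem mainTheorem2 {R : Type*} [CommRing R] [Finite R] [IsLocalRing R] [IsPrincipalIdealRing R]
    (hodd : Odd (ringChar R))
    (x : R) (hx : IsLocalRing.maximalIdeal R = Ideal.span {x})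
    {V : Type*} [AddCommGroup V] [Module (RamifiedWeil.Ext R x) V] [Module.Free (RamifiedWeil.Ext R x) V]
    [Module.Finite (RamifiedWeil.Ext R x) V]
    (h : RamifiedWeil.Form R x V) (hherm : ∀ u v, h v u = star (h u v)) (hnondeg : Function.Bijective h)
    (lam : AddChar R ℂ) (hlam : lam.IsPrimitive)
    (m ℓ q : ℕ) (hm : Module.finrank (RamifiedWeil.Ext R x) V = m) (hm1 : 1 ≤ m) (hℓ : RamifiedWeil.nilDeg R = ℓ)
    (hq : Nat.card (IsLocalRing.ResidueField R) = q) :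
    -- the number of constituents, both up to isomorphism and counted with multiplicity
    RamifiedWeil.numConstituents (RamifiedWeil.weilRep hx h lam) = Nat.card (MulAction.orbitRel.Quotient (RamifiedWeil.unitaryGrp h) V) ∧
    Module.length (MonoidAlgebra ℂ (RamifiedWeil.unitaryGrp h)) (RamifiedWeil.weilRep hx h lam).asModule =
      Nat.card (MulAction.orbitRel.Quotient (RamifiedWeil.unitaryGrp h) V) ∧
    (m = 1 → Nat.card (MulAction.orbitRel.Quotient (RamifiedWeil.unitaryGrp h) V) = q ^ ℓ) ∧
    (∀ ε : Rˣ, ¬ IsSquare ε → m = 2 → RamifiedWeil.HasType h ![1, -ε] →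
      Nat.card (MulAction.orbitRel.Quotient (RamifiedWeil.unitaryGrp h) V) = 2 * q ^ ℓ - 1) ∧
    (2 < m ∨ (m = 2 ∧ RamifiedWeil.HasType h ![1, -1]) →
      Nat.card (MulAction.orbitRel.Quotient (RamifiedWeil.unitaryGrp h) V) =
        2 * (∑ i ∈ Finset.Icc 1 ℓ, q ^ i) + 1) := by
  have H : RamifiedWeil.IsNondegHerm h :=
    ⟨RamifiedWeil.isUnit_two_of_odd_ringChar hodd, hx, hherm, hnondeg⟩
  -- Used with `p` equal to `2 N` in rank one and to `N` in the anisotropic plane, which avoids the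
  -- subtraction `q - 1`.
  have hgeom : ∀ p, p + 1 = q → (∑ i ∈ Finset.range ℓ, q ^ i) * p + 1 = q ^ ℓ := by
    rintro p rfl
    exact geom_sum_mul_add p ℓ
  have hcard := H.card_orbits
  rw [hℓ, hq] at hcard
  obtain ⟨r, hr⟩ : ∃ r : Fin m → Rˣ, RamifiedWeil.HasType h r := hm ▸ H.exists_hasType
  refine ⟨(H.constituents_weilRep hlam).1, (H.constituents_weilRep hlam).2, ?_, ?_, ?_⟩
  · rintro rfl
    have h1 := H.card_primRes_rank_one hr
    rw [hcard, ← hgeom _ (h1.trans hq)]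
    ring
  · rintro ε hε - hr
    have h1 := hgeom _ ((H.card_primRes_anisotropic hε hr).trans hq)
    rw [hcard, ← h1, mul_comm (Nat.card _)]
    omega
  · intro hcase
    have h1 : Nat.card (RamifiedWeil.primRes h) = q := by
      rw [← hq]
      obtain hlt | ⟨-, hr⟩ := hcase
      · obtain ⟨n, rfl⟩ : ∃ n, m = n + 3 := ⟨m - 3, by omega⟩
        exact H.card_primRes_of_three_le hr
      · exact H.card_primRes_hyperbolic hr
    rw [hcard, h1, Finset.mul_sum, Finset.range_eq_Ico]
    simp only [← pow_succ']
    rw [Finset.sum_Ico_add' (fun i => q ^ i) 0 ℓ 1, zero_add, Finset.Ico_add_one_right_eq_Icc]
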